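/- Let $\Omega\subset\mathbb R^m$ be a domain (a non-empty connected open set), and for $S\subset\mathbb R^m$ put $T_S=\{z=x+iy\in\mathbb C^m:\ x\in\mathbb R^m,\ y\in S\}$. A continuous function $u$ on $T_S$ is called almost-periodic on $T_S$ if for every sequence $(h_n)$ in $\mathbb R^m$ the sequence $u(z+h_n)$ has a subsequence that converges uniformly on $T_S$; almost-periodic functions on $\mathbb R^m$ are defined in the same way. A continuous function on $T_\Omega$ is called almost-periodic on $T_\Omega$ if its restriction to $T_K$ is almost-periodic on $T_K$ for every compact $K\subset\Omega$. A distribution $F\in\mathcal D'(T_\Omega)$ is called almost-periodic if for every test function $\varphi\in\mathcal D(T_\Omega)$ the function $t\mapsto\langle F(z),\varphi(z-t)\rangle$ is almost-periodic on $\mathbb R^m$. **Theorem.** Let $f$ be a holomorphic function on the tube domain $T_\Omega$, $f\not\equiv0$. Then $\log|f|$ is locally integrable on $T_\Omega$ with respect to Lebesgue measure, and so defines the distribution $\varphi\mapsto\int_{T_\Omega}\log|f(z)|\,\varphi(z)\,dx\,dy$ on $T_\Omega$; and $|f|$ is an almost-periodic function on $T_\Omega$ if and only if this distribution $\log|f|$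 is almost-periodic. -/

import Mathlib

open Filter Topology MeasureTheory TopologicalSpace
open scoped ContDiff Distributions

noncomputable section

namespace AlmostPeriodic

/-- The inclusion of `ℝᵐ` in `ℂᵐ`. -/
def realVec {m : ℕ} (t : Fin m → ℝ) : Fin m → ℂ := fun j => (t j : ℂ)

/-- The imaginary part `y` of `z = x + iy`. -/
def imVec {m : ℕ} (z : Fin m → ℂ) : Fin m → ℝ := fun j => (z j).im

/-- The tube set `{x + iy : x ∈ ℝᵐ, y ∈ S}` over `S ⊆ ℝᵐ`. -/
def tube {m : ℕ} (S : Set (Fin m → ℝ)) : Set (Fin m → ℂ) := {z | imVec z ∈ S}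

theorem continuous_imVec {m : ℕ} : Continuous (imVec : (Fin m → ℂ) → Fin m → ℝ) :=
  continuous_pi fun j => Complex.continuous_im.comp (continuous_apply j)

theorem imVec_sub_realVec {m : ℕ} (z : Fin m → ℂ) (t : Fin m → ℝ) :
    imVec (z - realVec t) = imVec z := by
  funext j
  simp [imVec, realVec]

/-- The tube over an open set, as an open subset of `ℂᵐ`. -/
def openTube {m : ℕ} (Ω : Opens (Fin m → ℝ)) : Opens (Fin m → ℂ) :=
  ⟨tube (Ω : Set (Fin m → ℝ)), Ω.isOpen.preimage continuous_imVec⟩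

/-- Almost periodic functions on `ℝᵐ`: continuous functions such that every sequence of shifts
has a uniformly convergent subsequence. -/
def IsAPFunction {m : ℕ} {E : Type*} [NormedAddCommGroup E] (u : (Fin m → ℝ) → E) : Prop :=
  Continuous u ∧ ∀ h : ℕ → Fin m → ℝ, ∃ k : ℕ → ℕ, StrictMono k ∧
    ∃ g : (Fin m → ℝ) → E, TendstoUniformly (fun n x => u (x + h (k n))) g atTop

/-- Almost periodic functions on the tube set over an arbitrary `S ⊆ ℝᵐ`: continuous functions such
that every sequence of real shifts has a subsequence converging uniformly on the whole tube set. -/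
def IsAPOnTubeSet {m : ℕ} {E : Type*} [NormedAddCommGroup E] (S : Set (Fin m → ℝ))
    (u : (Fin m → ℂ) → E) : Prop :=
  ContinuousOn u (tube S) ∧ ∀ h : ℕ → Fin m → ℝ, ∃ k : ℕ → ℕ, StrictMono k ∧
    ∃ g : (Fin m → ℂ) → E,
      TendstoUniformlyOn (fun n z => u (z + realVec (h (k n)))) g atTop (tube S)

/-- Almost periodic functions on the tube domain over an open `Ω ⊆ ℝᵐ`: continuous functions that
are almost periodic on every tube set with compact base `K ⊆ Ω`. -/
def IsAPOnTubeDomain {m : ℕ} {E : Type*} [NormedAddCommGroup E] (Ω : Opens (Fin m → ℝ))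
    (u : (Fin m → ℂ) → E) : Prop :=
  ContinuousOn u (tube (Ω : Set (Fin m → ℝ))) ∧
    ∀ K : Set (Fin m → ℝ), IsCompact K → K ⊆ (Ω : Set (Fin m → ℝ)) → IsAPOnTubeSet K u

/-- The translated test function `z ↦ φ (z - t)`, for a real vector `t`. -/
def translate {m : ℕ} {Ω : Opens (Fin m → ℝ)} (t : Fin m → ℝ) (φ : 𝓓(openTube Ω, ℝ)) :
    𝓓(openTube Ω, ℝ) where
  toFun z := φ (z - realVec t)
  contDiff' := φ.contDiff.comp (contDiff_id.sub contDiff_const)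
  hasCompactSupport' := φ.hasCompactSupport.comp_homeomorph (Homeomorph.subRight (realVec t))
  tsupport_subset' := by
    intro z hz
    have h : z - realVec t ∈ tsupport φ :=
      tsupport_comp_subset_preimage φ (Homeomorph.subRight (realVec t)).continuous hz
    have h' : imVec (z - realVec t) ∈ (Ω : Set (Fin m → ℝ)) := φ.tsupport_subset h
    rw [imVec_sub_realVec] at h'
    exact h'

/-- Almost periodic distributions on the tube domain over `Ω`: for every test function `φ`, the
function `t ↦ ⟨F(z), φ(z - t)⟩` is almost periodic on `ℝᵐ`. -/
def IsAPDistribution {m : ℕ} {Ω : Opens (Fin m → ℝ)} {E : Type*} [NormedAddCommGroup E]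
    [NormedSpace ℝ E] (F : 𝓓'(openTube Ω, E)) : Prop :=
  ∀ φ : 𝓓(openTube Ω, ℝ), IsAPFunction fun t : Fin m → ℝ => F (translate t φ)

/-- The regular distribution `φ ↦ ∫ φ(z) u(z) dx dy` given by a function `u` that is locally
integrable on the open set `U` of `ℂᵐ` (and zero if `u` is not locally integrable on `U`). -/
def regularDistribution {m : ℕ} (U : Opens (Fin m → ℂ)) (u : (Fin m → ℂ) → ℝ) : 𝓓'(U, ℝ) :=
  (TestFunction.integralAgainstBilinCLM (ContinuousLinearMap.mul ℝ ℝ) volume u :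
    𝓓(U, ℝ) →L[ℝ] ℝ)

theorem regularDistribution_apply {m : ℕ} {U : Opens (Fin m → ℂ)} {u : (Fin m → ℂ) → ℝ}
    (hu : LocallyIntegrableOn u (U : Set (Fin m → ℂ))) (φ : 𝓓(U, ℝ)) :
    regularDistribution U u φ = ∫ z, φ z * u z :=
  TestFunction.integralAgainstBilinCLM_eq_integral hu

end AlmostPeriodic

end

noncomputable section

namespace AlmostPeriodic

open Metric Set
open scoped ENNReal NNReal BoundedContinuousFunction

/-! Where `|f| ≤ e^C`, the nonnegative function `C - log |f|` is superharmonic: its rotation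
invariant means are at most its value at the centre (`lintegral_weight_negLog_le`). A centre at
which `|f|` is bounded below therefore bounds the integral over a whole ball, which already gives
local integrability.

Suppose `|f|` is almost periodic. The translates `f(· + a)` are bounded on tubes with compact base,
and none of their sequences can tend to zero near a point: smallness would spread over the connected
tube (`exists_nhds_tendstoUniformlyOn_zero`), so a uniform limit of the moduli over one horizontal
plane would vanish, although shifting back always recovers a fixed nonzero value
(`exists_le_norm_of_isAPOnTubeDomain`). Hence the functions `C - log |f(· + a)|` have bounded
integrals on compact sets, and superharmonicity improves this to uniform integrability
(`lintegral_le_lintegral_min_add`). Truncated logarithms are Lipschitz in the modulus, so uniform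
closeness of two translates of `|f|` gives closeness of the pairings of `log |f|` with a test
function (`exists_abs_integral_sub_le`).

Conversely, Banach–Steinhaus bounds the pairings over all real shifts and a compact family of bumps
(`exists_abs_integral_le`). The sub-mean value property turns this into an upper bound for `|f|` on
tubes with compact base, and the Schwarz lemma into a uniform Lipschitz estimate. If `|f(z + a)|`
exceeds `|f(z + b)|` by `ε`, it still does so by `ε/2` on a ball of fixed size, where the logarithms
then differ by at least `(ε/2) e^{-C}`; no lower bound for `|f|` is needed. Real shifts take care of
the real part of `z`, so bumps over a finite net of imaginary parts detect the gap
(`exists_finset_bumpAt`), and a diagonal subsequence finishes. -/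

/-! ### Superharmonicity of `C - log |F|` -/

/-- The superharmonic function `C - log x`, as an extended nonnegative number which is infinite at
`x = 0`. -/
def negLog (C x : ℝ) : ℝ≥0∞ := if x = 0 then ⊤ else ENNReal.ofReal (C - Real.log x)

theorem negLog_of_ne {C x : ℝ} (hx : x ≠ 0) : negLog C x = ENNReal.ofReal (C - Real.log x) :=
  if_neg hx

theorem measurable_negLog (C : ℝ) : Measurable (negLog C) :=
  Measurable.ite (measurableSet_singleton 0) measurable_const
    (measurable_const.sub Real.measurable_log).ennreal_ofReal

theorem log_le_of_norm_le {C x : ℝ} (h0 : 0 ≤ x) (hx : x ≠ 0) (h : x ≤ Real.exp C) :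
    Real.log x ≤ C :=
  (Real.log_le_iff_le_exp (lt_of_le_of_ne h0 hx.symm)).2 h

/-- Jensen's formula: the excess of the circle average is a sum over the zeros `u` in the disc of
multiplicity times `log (1/|u|)`, and every term is nonnegative. -/
theorem log_norm_le_circleAverage {F : ℂ → ℂ} (hF : AnalyticOnNhd ℂ F (closedBall 0 1))
    (h0 : F 0 ≠ 0) :
    Real.log ‖F 0‖ ≤ Real.circleAverage (fun z => Real.log ‖F z‖) 0 1 := by
  have h1 : AnalyticOnNhd ℂ F (closedBall 0 |1|) := by simpa using hF
  rw [AnalyticOnNhd.circleAverage_log_norm one_ne_zero h1 h0, le_add_iff_nonneg_left]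
  refine finsum_nonneg fun u => ?_
  by_cases hu : u ∈ closedBall (0 : ℂ) |1|
  · refine mul_nonneg ?_ ?_
    · exact_mod_cast (MeromorphicOn.AnalyticOnNhd.divisor_nonneg h1) u
    · rw [one_mul, Real.log_inv, neg_nonneg]
      refine Real.log_nonpos (norm_nonneg _) ?_
      simpa using hu
  · rw [Function.locallyFinsuppWithin.apply_eq_zero_of_notMem _ hu]
    simp

/-- The zeros are discrete. This is needed because `Real.log 0 = 0` while `negLog C 0 = ⊤`: the two
agree only off the zero set. -/
theorem ae_circleMap_ne_zero {F : ℂ → ℂ} (hF : AnalyticOnNhd ℂ F (closedBall 0 1))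
    (h0 : F 0 ≠ 0) :
    ∀ᵐ θ ∂(volume.restrict (Ioc 0 (2 * Real.pi))), F (circleMap 0 1 θ) ≠ 0 := by
  have h1 : F ⁻¹' {0}ᶜ ∈ codiscreteWithin (closedBall (0 : ℂ) 1) :=
    hF.preimage_zero_mem_codiscreteWithin h0 (by simp)
      ((convex_closedBall (0 : ℂ) 1).isConnected ⟨0, by simp⟩)
  have h2 := circleMap_preimage_codiscrete (c := 0) (R := 1) one_ne_zero
    (show F ⁻¹' {0}ᶜ ∈ codiscreteWithin (sphere (0 : ℂ) |1|) from
      codiscreteWithin_mono (by simpa using sphere_subset_closedBall) h1)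
  have h3 := ae_restrict_le_codiscreteWithin (μ := volume) (U := Ioc 0 (2 * Real.pi))
    measurableSet_Ioc (codiscreteWithin_mono (subset_univ _) h2)
  filter_upwards [h3] with θ hθ using hθ

theorem lintegral_circle_negLog_le {F : ℂ → ℂ} {C : ℝ}
    (hF : AnalyticOnNhd ℂ F (closedBall 0 1)) (h0 : F 0 ≠ 0)
    (hC : ∀ z ∈ closedBall (0 : ℂ) 1, ‖F z‖ ≤ Real.exp C) :
    ∫⁻ θ in Ioc 0 (2 * Real.pi), negLog C ‖F (circleMap 0 1 θ)‖ ≤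
      ENNReal.ofReal (2 * Real.pi) * negLog C ‖F 0‖ := by
  have hmem : ∀ θ, circleMap (0 : ℂ) 1 θ ∈ closedBall (0 : ℂ) 1 := fun θ => by simp
  have hne := ae_circleMap_ne_zero hF h0
  have hint : IntegrableOn (fun θ => Real.log ‖F (circleMap 0 1 θ)‖) (Ioc 0 (2 * Real.pi)) := by
    have : CircleIntegrable (fun z => Real.log ‖F z‖) 0 1 := by
      refine MeromorphicOn.circleIntegrable_log_norm ?_
      exact (hF.mono (by simpa using sphere_subset_closedBall)).meromorphicOn
    exact (intervalIntegrable_iff_integrableOn_Ioc_of_le Real.two_pi_pos.le).1 this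
  have hconst : IntegrableOn (fun _ : ℝ => C) (Ioc 0 (2 * Real.pi)) :=
    integrableOn_const measure_Ioc_lt_top.ne
  have hint' : IntegrableOn (fun θ => C - Real.log ‖F (circleMap 0 1 θ)‖) (Ioc 0 (2 * Real.pi)) :=
    hconst.sub hint
  have key : ∫⁻ θ in Ioc 0 (2 * Real.pi), negLog C ‖F (circleMap 0 1 θ)‖ =
      ENNReal.ofReal (∫ θ in Ioc 0 (2 * Real.pi), (C - Real.log ‖F (circleMap 0 1 θ)‖)) := by
    rw [ofReal_integral_eq_lintegral_ofReal hint']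
    · refine lintegral_congr_ae ?_
      filter_upwards [hne] with θ hθ
      rw [negLog_of_ne (by simpa using hθ)]
    · filter_upwards [hne] with θ hθ
      exact sub_nonneg.2 (log_le_of_norm_le (norm_nonneg _) (by simpa using hθ) (hC _ (hmem θ)))
  have hav := log_norm_le_circleAverage hF h0
  rw [Real.circleAverage_def, intervalIntegral.integral_of_le Real.two_pi_pos.le, smul_eq_mul,
    inv_mul_eq_div, le_div_iff₀ Real.two_pi_pos] at hav
  rw [key, negLog_of_ne (by simpa using h0), ← ENNReal.ofReal_mul Real.two_pi_pos.le,
    integral_sub hconst hint]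
  refine ENNReal.ofReal_le_ofReal ?_
  have : ∫ _ in Ioc 0 (2 * Real.pi), C = 2 * Real.pi * C := by
    simp [Real.pi_pos.le]
  rw [this]
  linarith

theorem measurePreserving_circle_smul {m : ℕ} (θ : ℝ) :
    MeasurePreserving (fun ζ : Fin m → ℂ => circleMap 0 1 θ • ζ) := by
  have h1 : MeasurePreserving (fun w : ℂ => circleMap 0 1 θ * w) := by
    have := (rotation (Circle.exp θ)).measurePreserving
    refine (?_ : (fun w : ℂ => circleMap 0 1 θ * w) = rotation (Circle.exp θ)) ▸ this
    ext w
    simp [circleMap, rotation_apply]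
  exact volume_preserving_pi (fun _ : Fin m => h1)

/-- The superharmonicity of `-log |F|`, in the form of an inequality for means with respect to a
rotation invariant weight. -/
theorem lintegral_weight_negLog_le {m : ℕ} {U : Set (Fin m → ℂ)} {F : (Fin m → ℂ) → ℂ}
    (hU : IsOpen U) (hF : DifferentiableOn ℂ F U) (hFm : Measurable F) {z : Fin m → ℂ} {r C : ℝ}
    (hzU : closedBall z r ⊆ U) (hz : F z ≠ 0) (hC : ∀ w ∈ closedBall z r, ‖F w‖ ≤ Real.exp C)
    {ρ : (Fin m → ℂ) → ℝ≥0∞} (hρ : Measurable ρ)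
    (hρr : ∀ θ ζ, ρ (circleMap 0 1 θ • ζ) = ρ ζ) (hρ0 : ∀ ζ, r < ‖ζ‖ → ρ ζ = 0) :
    ∫⁻ ζ, ρ ζ * negLog C ‖F (z + ζ)‖ ≤ (∫⁻ ζ, ρ ζ) * negLog C ‖F z‖ := by
  have hg : Measurable fun w => negLog C ‖F w‖ := (measurable_negLog C).comp hFm.norm
  -- Both `ρ` and Lebesgue measure are rotation invariant, so the integral may be averaged over `θ`;
  -- after exchanging the integrals, Jensen's inequality applies on each disc `w ↦ z + w • ζ`.
  have hrot : ∀ θ : ℝ, ∫⁻ ζ, ρ ζ * negLog C ‖F (z + circleMap 0 1 θ • ζ)‖ =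
      ∫⁻ ζ, ρ ζ * negLog C ‖F (z + ζ)‖ := by
    intro θ
    have hm : Measurable fun ζ => ρ ζ * negLog C ‖F (z + ζ)‖ :=
      hρ.mul (hg.comp (measurable_const_add z))
    simpa only [hρr] using (measurePreserving_circle_smul θ).lintegral_comp hm
  have hpos : ENNReal.ofReal (2 * Real.pi) ≠ 0 := by simp [Real.pi_pos]
  have htop : ENNReal.ofReal (2 * Real.pi) ≠ ⊤ := ENNReal.ofReal_ne_top
  rw [← ENNReal.mul_le_mul_iff_right hpos htop]
  calc ENNReal.ofReal (2 * Real.pi) * ∫⁻ ζ, ρ ζ * negLog C ‖F (z + ζ)‖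
      = ∫⁻ θ in Ioc 0 (2 * Real.pi), ∫⁻ ζ, ρ ζ * negLog C ‖F (z + circleMap 0 1 θ • ζ)‖ := by
        simp only [hrot]
        simp [mul_comm]
    _ = ∫⁻ ζ, ∫⁻ θ in Ioc 0 (2 * Real.pi), ρ ζ * negLog C ‖F (z + circleMap 0 1 θ • ζ)‖ := by
        refine lintegral_lintegral_swap (Measurable.aemeasurable ?_)
        refine (hρ.comp measurable_snd).mul (hg.comp ?_)
        exact ((continuous_const.add (((continuous_circleMap 0 1).comp continuous_fst).smul
          continuous_snd)).measurable)
    _ ≤ ∫⁻ ζ, ρ ζ * (ENNReal.ofReal (2 * Real.pi) * negLog C ‖F z‖) := by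
        refine lintegral_mono fun ζ => ?_
        have hc : Continuous fun θ => z + circleMap 0 1 θ • ζ := by fun_prop
        have hm : Measurable fun θ => negLog C ‖F (z + circleMap 0 1 θ • ζ)‖ :=
          hg.comp hc.measurable
        rw [lintegral_const_mul _ hm]
        by_cases hζ : r < ‖ζ‖
        · simp [hρ0 ζ hζ]
        gcongr
        have hmem : ∀ w ∈ closedBall (0 : ℂ) 1, z + w • ζ ∈ closedBall z r := by
          intro w hw
          rw [mem_closedBall, dist_eq_norm, add_sub_cancel_left, norm_smul]
          have hw' : ‖w‖ ≤ 1 := by simpa using hw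
          nlinarith [norm_nonneg ζ, norm_nonneg w]
        have hcont : Continuous fun w : ℂ => z + w • ζ := by fun_prop
        have hd : Differentiable ℂ fun w : ℂ => z + w • ζ := by fun_prop
        have han : AnalyticOnNhd ℂ (fun w : ℂ => F (z + w • ζ)) (closedBall 0 1) := by
          have : DifferentiableOn ℂ (fun w : ℂ => F (z + w • ζ)) ((fun w : ℂ => z + w • ζ) ⁻¹' U) :=
            hF.comp hd.differentiableOn (fun w hw => hw)
          exact (this.analyticOnNhd (hU.preimage hcont)).mono fun w hw => hzU (hmem w hw)
        have := lintegral_circle_negLog_le (C := C) han (by simpa using hz)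
          (fun w hw => hC _ (hmem w hw))
        simpa using this
    _ = ENNReal.ofReal (2 * Real.pi) * ((∫⁻ ζ, ρ ζ) * negLog C ‖F z‖) := by
        rw [lintegral_mul_const _ hρ]
        ring

theorem setLIntegral_closedBall_negLog_le {m : ℕ} {U : Set (Fin m → ℂ)} {F : (Fin m → ℂ) → ℂ}
    (hU : IsOpen U) (hF : DifferentiableOn ℂ F U) (hFm : Measurable F) {z : Fin m → ℂ} {r C : ℝ}
    (hzU : closedBall z r ⊆ U) (hz : F z ≠ 0) (hC : ∀ w ∈ closedBall z r, ‖F w‖ ≤ Real.exp C) :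
    ∫⁻ w in closedBall z r, negLog C ‖F w‖ ≤
      volume (closedBall (0 : Fin m → ℂ) r) * negLog C ‖F z‖ := by
  have h := lintegral_weight_negLog_le hU hF hFm hzU hz hC
    (ρ := (closedBall (0 : Fin m → ℂ) r).indicator 1)
    (measurable_one.indicator measurableSet_closedBall)
    (fun θ ζ => by
      simp only [indicator, mem_closedBall, dist_zero_right, norm_smul, norm_circleMap_zero,
        abs_one, one_mul, Pi.one_apply])
    (fun ζ hζ => indicator_of_notMem (by simpa using hζ) _)
  rw [lintegral_indicator_one measurableSet_closedBall] at h
  refine le_trans (le_of_eq ?_) h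
  rw [← lintegral_indicator measurableSet_closedBall, ← lintegral_add_left_eq_self _ z]
  refine lintegral_congr fun ζ => ?_
  by_cases hζ : ‖ζ‖ ≤ r <;> simp [indicator, hζ, dist_eq_norm]

/-! ### Uniform integrability from the mean value inequality -/

/-- Uniform integrability of positive superharmonic functions: the integral of such a function `g`
differs from that of its truncation by an amount controlled by its total mass. -/
theorem lintegral_le_lintegral_min_add {m : ℕ} {g χ : (Fin m → ℂ) → ℝ≥0∞} (hg : Measurable g)
    (hχ : Measurable χ) {S T : Set (Fin m → ℂ)} (hS : MeasurableSet S) {r : ℝ}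
    (hST : ∀ z ∈ S, closedBall z r ⊆ T)
    {B : ℝ≥0∞} (hB : ∫⁻ z in T, g z ≤ B) (hST' : S ⊆ T)
    (hmean : ∀ z ∈ S, g z ≠ ⊤ → ∫⁻ w in closedBall z r, g w ≤
      volume (closedBall (0 : Fin m → ℂ) r) * g z)
    (hv0 : volume (closedBall (0 : Fin m → ℂ) r) ≠ 0)
    (hχS : ∀ z, z ∉ S → χ z = 0) (hχ1 : ∀ z, χ z ≤ 1) {d : ℝ≥0∞}
    (hχc : ∀ z w, dist z w ≤ r → χ z ≤ χ w + d) {N : ℝ≥0∞} (hN0 : N ≠ 0) (hN : N ≠ ⊤) :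
    ∫⁻ z, χ z * g z ≤ (∫⁻ z, χ z * min (g z) N) +
      (d + B / N / volume (closedBall (0 : Fin m → ℂ) r)) * B := by
  set v := volume (closedBall (0 : Fin m → ℂ) r) with hv
  have hvt : v ≠ ⊤ := measure_closedBall_lt_top.ne
  have hvol : ∀ z : Fin m → ℂ, volume (closedBall z r) = v := fun z =>
    Measure.addHaar_closedBall_center _ _ _
  set G : Set (Fin m → ℂ) := {z | g z ≤ N} with hG
  have hGm : MeasurableSet G := measurableSet_le hg measurable_const
  -- Chebyshev's inequality: the bad set `{g > N}` has volume at most `B / N`.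
  have hsmall : ∀ ζ ∈ S, volume (closedBall ζ r \ G) ≤ B / N := by
    intro ζ hζ
    rw [ENNReal.le_div_iff_mul_le (Or.inl hN0) (Or.inl hN), mul_comm]
    calc N * volume (closedBall ζ r \ G)
        = ∫⁻ _ in closedBall ζ r \ G, N := by simp
      _ ≤ ∫⁻ z in closedBall ζ r \ G, g z :=
          setLIntegral_mono' (measurableSet_closedBall.diff hGm) fun z hz =>
            (not_le.1 (show ¬ g z ≤ N from hz.2)).le
      _ ≤ ∫⁻ z in T, g z := lintegral_mono_set (sdiff_subset.trans (hST ζ hζ))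
      _ ≤ B := hB
  -- `χ ζ` is compared with its average over the good part of the ball; the errors are the
  -- oscillation `d` and the volume of the bad part.
  have hχm : ∀ ζ ∈ S, v * χ ζ ≤ (∫⁻ z in closedBall ζ r, G.indicator χ z) + (B / N + v * d) := by
    intro ζ hζ
    calc v * χ ζ = ∫⁻ _ in closedBall ζ r, χ ζ := by simp [hvol, mul_comm]
      _ ≤ ∫⁻ z in closedBall ζ r, (G.indicator χ z + (Gᶜ.indicator 1 z + d)) := by
          refine setLIntegral_mono' measurableSet_closedBall fun z hz => ?_
          refine (hχc ζ z (by rwa [dist_comm])).trans ?_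
          rw [← add_assoc]
          gcongr
          by_cases hzG : z ∈ G
          · simp [hzG]
          · simpa [hzG] using hχ1 z
      _ = (∫⁻ z in closedBall ζ r, G.indicator χ z) + (volume (closedBall ζ r \ G) + v * d) := by
          rw [lintegral_add_left (hχ.indicator hGm),
            lintegral_add_left (measurable_one.indicator hGm.compl),
            lintegral_indicator_one hGm.compl, Measure.restrict_apply hGm.compl, inter_comm]
          simp [hvol, mul_comm, sdiff_eq]
      _ ≤ _ := by
          gcongr
          exact hsmall ζ hζ
  have hker : MeasurableSet {p : (Fin m → ℂ) × (Fin m → ℂ) | dist p.1 p.2 ≤ r} :=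
    measurableSet_le measurable_dist measurable_const
  -- Fubini moves the average from `χ` onto `g`. The mean value inequality is then used only at
  -- centres in `G`, where `g ≤ N`, so the large values of `g` have been absorbed.
  have hfub : ∫⁻ ζ in S, g ζ * ∫⁻ z in closedBall ζ r, G.indicator χ z ≤
      v * ∫⁻ z, G.indicator χ z * g z := by
    have hk : ∀ z ζ : Fin m → ℂ, (closedBall ζ r).indicator (G.indicator χ) z =
        G.indicator χ z * (closedBall z r).indicator 1 ζ := by
      intro z ζ
      by_cases h : dist z ζ ≤ r
      · simp [indicator, h, dist_comm ζ z]
      · simp [indicator, h, dist_comm ζ z]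
    have hkm : Measurable fun p : (Fin m → ℂ) × (Fin m → ℂ) =>
        (closedBall p.2 r).indicator (1 : (Fin m → ℂ) → ℝ≥0∞) p.1 := by
      have : (fun p : (Fin m → ℂ) × (Fin m → ℂ) =>
          (closedBall p.2 r).indicator (1 : (Fin m → ℂ) → ℝ≥0∞) p.1) =
          {p : (Fin m → ℂ) × (Fin m → ℂ) | dist p.1 p.2 ≤ r}.indicator 1 := by
        ext p
        simp [indicator]
      rw [this]
      exact measurable_one.indicator hker
    have hGχ : Measurable (G.indicator χ) := hχ.indicator hGm
    calc ∫⁻ ζ in S, g ζ * ∫⁻ z in closedBall ζ r, G.indicator χ z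
        = ∫⁻ ζ in S, ∫⁻ z, g ζ * (G.indicator χ z * (closedBall z r).indicator 1 ζ) := by
          refine lintegral_congr fun ζ => ?_
          simp_rw [← lintegral_indicator measurableSet_closedBall, hk]
          rw [lintegral_const_mul]
          simp_rw [← hk]
          exact hGχ.indicator measurableSet_closedBall
      _ = ∫⁻ z, ∫⁻ ζ in S, g ζ * (G.indicator χ z * (closedBall z r).indicator 1 ζ) := by
          refine lintegral_lintegral_swap (Measurable.aemeasurable ?_)
          exact (hg.comp measurable_fst).mul ((hGχ.comp measurable_snd).mul hkm)
      _ ≤ ∫⁻ z, v * (G.indicator χ z * g z) := by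
          refine lintegral_mono fun z => ?_
          by_cases hz : z ∈ G ∧ z ∈ S
          · have h1 : Measurable fun ζ => (closedBall z r).indicator g ζ :=
              hg.indicator measurableSet_closedBall
            calc ∫⁻ ζ in S, g ζ * (G.indicator χ z * (closedBall z r).indicator 1 ζ)
                ≤ ∫⁻ ζ, G.indicator χ z * (closedBall z r).indicator g ζ := by
                  refine (setLIntegral_le_lintegral _ _).trans (lintegral_mono fun ζ => ?_)
                  by_cases hζ : ζ ∈ closedBall z r
                  · simp only [indicator_of_mem hζ, Pi.one_apply, mul_one]
                    exact (mul_comm _ _).le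
                  · simp [indicator_of_notMem hζ]
              _ = G.indicator χ z * ∫⁻ ζ in closedBall z r, g ζ := by
                  rw [lintegral_const_mul _ h1, lintegral_indicator measurableSet_closedBall]
              _ ≤ G.indicator χ z * (v * g z) := by
                  gcongr
                  exact hmean z hz.2 (ne_top_of_le_ne_top hN hz.1)
              _ = v * (G.indicator χ z * g z) := by ring
          · have h0 : G.indicator χ z = 0 := by
              by_cases hzG : z ∈ G
              · rw [indicator_of_mem hzG]
                exact hχS z fun hzS => hz ⟨hzG, hzS⟩
              · exact indicator_of_notMem hzG _
            simp [h0]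
      _ = v * ∫⁻ z, G.indicator χ z * g z := lintegral_const_mul _ (hGχ.mul hg)
  have hmin : ∫⁻ z, G.indicator χ z * g z ≤ ∫⁻ z, χ z * min (g z) N := by
    refine lintegral_mono fun z => ?_
    by_cases hz : z ∈ G
    · rw [indicator_of_mem hz, min_eq_left hz]
    · simp [hz]
  have hsupp : ∫⁻ z, χ z * g z = ∫⁻ z in S, χ z * g z := by
    rw [← lintegral_indicator hS]
    refine lintegral_congr fun z => ?_
    by_cases hz : z ∈ S
    · simp [hz]
    · simp [hz, hχS z hz]
  have hχg : Measurable fun z => χ z * g z := hχ.mul hg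
  rw [← ENNReal.mul_le_mul_iff_right hv0 hvt, hsupp, ← lintegral_const_mul v hχg]
  calc ∫⁻ z in S, v * (χ z * g z)
      ≤ ∫⁻ ζ in S, (g ζ * (∫⁻ z in closedBall ζ r, G.indicator χ z) + (B / N + v * d) * g ζ) := by
        refine setLIntegral_mono' hS fun ζ hζ => ?_
        rw [← mul_assoc, mul_comm (g ζ), ← add_mul]
        gcongr
        exact hχm ζ hζ
    _ = (∫⁻ ζ in S, g ζ * ∫⁻ z in closedBall ζ r, G.indicator χ z) +
          (B / N + v * d) * ∫⁻ ζ in S, g ζ := by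
        rw [lintegral_add_right _ (hg.const_mul _), lintegral_const_mul _ hg]
    _ ≤ v * (∫⁻ z, χ z * min (g z) N) + (B / N + v * d) * B := by
        gcongr
        · exact hfub.trans (by gcongr)
        · exact (lintegral_mono_set hST').trans hB
    _ = v * ((∫⁻ z, χ z * min (g z) N) + (d + B / N / v) * B) := by
        have : v * (B / N / v) = B / N := ENNReal.mul_div_cancel hv0 hvt
        rw [mul_add, ← mul_assoc, mul_add v, this, add_comm (v * d)]

/-- The preceding estimate is applied with a cutoff equal to one on `S`: first `r` is made small to
control its oscillation, then `N` large. Neither choice depends on `i`. -/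
theorem exists_lintegral_sub_le {m : ℕ} {ι : Type*} {g : ι → (Fin m → ℂ) → ℝ≥0∞}
    (hg : ∀ i, Measurable (g i)) {S : Set (Fin m → ℂ)} {R : ℝ} (hR : 0 < R)
    (hS : IsCompact S) {B : ℝ≥0} (hB : ∀ i, ∫⁻ z in cthickening R S, g i z ≤ B)
    (hmean : ∀ i z r, closedBall z r ⊆ cthickening R S → g i z ≠ ⊤ →
      ∫⁻ w in closedBall z r, g i w ≤ volume (closedBall (0 : Fin m → ℂ) r) * g i z)
    {ε : ℝ≥0} (hε : 0 < ε) : ∃ N : ℝ≥0, ∀ i, ∫⁻ z in S, (g i z - N) ≤ ε := by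
  set δ := R / 2 with hδ
  have hδ0 : 0 < δ := by positivity
  -- This gives `d * B ≤ ε / 2`. The cutoff is `1/δ`-Lipschitz, so `r ≤ d * δ` keeps its oscillation
  -- below `d`; the later choice of `N` makes the Chebyshev term at most `ε / 2`.
  set d : ℝ≥0 := ε / (2 * (B + 1)) with hd
  have hd0 : 0 < d := by positivity
  set r : ℝ := δ * min (1 : ℝ) (d : ℝ) with hr
  have hr0 : 0 < r := mul_pos hδ0 (lt_min one_pos (by exact_mod_cast hd0))
  have hrδ : r ≤ δ := by
    have : min 1 (d : ℝ) ≤ 1 := min_le_left _ _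
    nlinarith
  have hrd : r ≤ d * δ := by
    have : min 1 (d : ℝ) ≤ d := min_le_right _ _
    nlinarith
  have hvt : volume (closedBall (0 : Fin m → ℂ) r) ≠ ⊤ := measure_closedBall_lt_top.ne
  have hv0 : volume (closedBall (0 : Fin m → ℂ) r) ≠ 0 :=
    (measure_closedBall_pos _ _ hr0).ne'
  obtain ⟨v, hv⟩ : ∃ v : ℝ≥0, (v : ℝ≥0∞) = volume (closedBall (0 : Fin m → ℂ) r) :=
    ⟨_, ENNReal.coe_toNNReal hvt⟩
  have hv0' : 0 < v := by
    rw [← hv] at hv0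
    exact pos_iff_ne_zero.2 (by exact_mod_cast hv0)
  set N : ℝ≥0 := 2 * B * B / (ε * v) + 1 with hN
  have hN0 : 0 < N := by positivity
  have hsmall : ((d : ℝ≥0∞) + B / N / v) * B ≤ ε := by
    have hreal : (d + B / N / v) * B ≤ ε := by
      have h1 : d * B ≤ ε / 2 := by
        rw [hd, div_mul_eq_mul_div, div_le_div_iff₀ (by positivity) (by positivity)]
        have : ε * B * 2 = ε * (2 * B) := by ring
        rw [this]
        gcongr
        exact le_self_add
      have h2 : B / N / v * B ≤ ε / 2 := by
        rw [div_div, div_mul_eq_mul_div, div_le_div_iff₀ (by positivity) (by positivity), hN]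
        have : ε * ((2 * B * B / (ε * v) + 1) * v) = B * B * 2 + ε * v := by
          field_simp
        rw [this]
        exact le_self_add
      calc (d + B / N / v) * B = d * B + B / N / v * B := by ring
        _ ≤ ε / 2 + ε / 2 := add_le_add h1 h2
        _ = ε := add_halves ε
    have := ENNReal.coe_le_coe.2 hreal
    rwa [ENNReal.coe_mul, ENNReal.coe_add, ENNReal.coe_div hv0'.ne', ENNReal.coe_div hN0.ne']
      at this
  refine ⟨N, fun i => ?_⟩
  set χ : (Fin m → ℂ) → ℝ≥0∞ := thickenedIndicatorAux δ S with hχ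
  have hχm : Measurable χ := (continuous_thickenedIndicatorAux hδ0 S).measurable
  have hball : ∀ z ∈ thickening δ S, closedBall z r ⊆ cthickening R S := by
    intro z hz w hw
    rw [mem_thickening_iff] at hz
    obtain ⟨s, hs, hzs⟩ := hz
    refine mem_cthickening_of_dist_le w s R S hs ?_
    have := dist_triangle w z s
    have hw' : dist w z ≤ r := hw
    linarith
  have h := lintegral_le_lintegral_min_add (hg i) hχm (S := thickening δ S) (T := cthickening R S)
    isOpen_thickening.measurableSet hball (hB i)
    (thickening_subset_cthickening_of_le (by linarith) S)
    (fun z hz hgz => hmean i z r (hball z hz) hgz) hv0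
    (fun z hz => thickenedIndicatorAux_zero hδ0 S hz) (fun z => thickenedIndicatorAux_le_one _ _ z)
    (d := d) (by
      intro z w hzw
      simp only [hχ, thickenedIndicatorAux]
      have h1 : infEDist w S ≤ infEDist z S + edist z w := by
        rw [add_comm, edist_comm]; exact infEDist_le_edist_add_infEDist
      have h2 : edist z w / ENNReal.ofReal δ ≤ d := by
        rw [ENNReal.div_le_iff (by simpa using hδ0) ENNReal.ofReal_ne_top, edist_dist,
          ← ENNReal.ofReal_coe_nnreal, ← ENNReal.ofReal_mul d.coe_nonneg]
        exact ENNReal.ofReal_le_ofReal (hzw.trans hrd)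
      have h3 : infEDist w S / ENNReal.ofReal δ ≤ infEDist z S / ENNReal.ofReal δ + d := by
        refine (ENNReal.div_le_div_right h1 _).trans ?_
        rw [ENNReal.add_div]
        gcongr
      rw [tsub_le_iff_right]
      calc (1 : ℝ≥0∞) ≤ 1 - infEDist w S / ENNReal.ofReal δ + infEDist w S / ENNReal.ofReal δ :=
            le_tsub_add
        _ ≤ 1 - infEDist w S / ENNReal.ofReal δ + (infEDist z S / ENNReal.ofReal δ + d) := by
            gcongr
        _ = _ := by ring)
    (N := N) (by exact_mod_cast hN0.ne') ENNReal.coe_ne_top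
  rw [← hv] at h
  -- Finiteness allows the truncated integral to be subtracted in `ℝ≥0∞`.
  have hfin : ∫⁻ z, χ z * min (g i z) N ≠ ⊤ := by
    refine ne_top_of_le_ne_top (b := ∫⁻ z in cthickening R S, (N : ℝ≥0∞)) ?_ ?_
    · rw [setLIntegral_const]
      exact ENNReal.mul_ne_top ENNReal.coe_ne_top (hS.cthickening.measure_lt_top).ne
    · rw [← lintegral_indicator isClosed_cthickening.measurableSet]
      refine lintegral_mono fun z => ?_
      by_cases hz : z ∈ cthickening R S
      · rw [indicator_of_mem hz]
        exact (mul_le_mul' (thickenedIndicatorAux_le_one _ _ z) (min_le_right _ _)).trans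
          (one_mul _).le
      · have : χ z = 0 := thickenedIndicatorAux_zero hδ0 S fun h' =>
          hz (thickening_subset_cthickening_of_le (by linarith) S h')
        simp [this]
  have hmm : Measurable fun z => χ z * min (g i z) N := hχm.mul ((hg i).min measurable_const)
  calc ∫⁻ z in S, (g i z - N)
      ≤ ∫⁻ z, (χ z * g i z - χ z * min (g i z) N) := by
        rw [← lintegral_indicator hS.measurableSet]
        refine lintegral_mono fun z => ?_
        by_cases hz : z ∈ S
        · have : χ z = 1 := thickenedIndicatorAux_one δ S hz
          rw [indicator_of_mem hz, this, one_mul, one_mul]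
          exact tsub_le_tsub_left (min_le_right _ _) _
        · simp [hz]
    _ = (∫⁻ z, χ z * g i z) - ∫⁻ z, χ z * min (g i z) N :=
        lintegral_sub hmm hfin (ae_of_all _ fun z => mul_le_mul_right (min_le_left _ _) _)
    _ ≤ ε := by
        rw [tsub_le_iff_left]
        exact h.trans (by gcongr)

theorem negLog_anti {C x y : ℝ} (hx : 0 ≤ x) (hxy : x ≤ y) : negLog C y ≤ negLog C x := by
  unfold negLog
  by_cases h : x = 0
  · simp [h]
  · have hx' : 0 < x := lt_of_le_of_ne hx (Ne.symm h)
    rw [if_neg h, if_neg (hx'.trans_le hxy).ne']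
    exact ENNReal.ofReal_le_ofReal (by linarith [Real.log_le_log hx' hxy])

/-! ### Propagation of smallness and uniform integrability for families -/

section Growth

variable {m : ℕ} {U : Set (Fin m → ℂ)}

/-- A bound of `|F|` on a set of positive measure controls `|F|` at the centre. -/
theorem volume_mul_negLog_le {F : (Fin m → ℂ) → ℂ} (hU : IsOpen U) (hF : DifferentiableOn ℂ F U)
    (hFm : Measurable F) {w : Fin m → ℂ} {r C : ℝ} (hwU : closedBall w r ⊆ U) (hw : F w ≠ 0)
    (hC : ∀ z ∈ closedBall w r, ‖F z‖ ≤ Real.exp C) {V : Set (Fin m → ℂ)} (hV : MeasurableSet V)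
    (hVw : V ⊆ closedBall w r) {δ : ℝ} (hδ : ∀ z ∈ V, ‖F z‖ ≤ δ) :
    volume V * negLog C δ ≤ volume (closedBall (0 : Fin m → ℂ) r) * negLog C ‖F w‖ := by
  refine le_trans ?_ (setLIntegral_closedBall_negLog_le hU hF hFm hwU hw hC)
  rw [mul_comm, ← setLIntegral_const]
  refine le_trans (setLIntegral_mono' hV fun z hz => ?_) (lintegral_mono_set hVw)
  exact negLog_anti (norm_nonneg _) (hδ z hz)

/-- Local uniform convergence to zero of a locally bounded sequence of holomorphic functions
propagates from a neighbourhood of a point to a connected open set. -/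
theorem exists_nhds_tendstoUniformlyOn_zero {F : ℕ → (Fin m → ℂ) → ℂ} (hU : IsOpen U)
    (hUc : IsPreconnected U) (hF : ∀ k, DifferentiableOn ℂ (F k) U) (hFm : ∀ k, Measurable (F k))
    (hb : ∀ z ∈ U, ∃ C : ℝ, ∃ V ∈ 𝓝 z, ∀ k, ∀ w ∈ V, ‖F k w‖ ≤ C)
    {z₁ : Fin m → ℂ} (hz₁ : z₁ ∈ U)
    (h₁ : ∃ V ∈ 𝓝 z₁, TendstoUniformlyOn F (fun _ => 0) atTop V) :
    ∀ z ∈ U, ∃ V ∈ 𝓝 z, TendstoUniformlyOn F (fun _ => 0) atTop V := by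
  set A : Set (Fin m → ℂ) := {z | ∃ V ∈ 𝓝 z, TendstoUniformlyOn F (fun _ => 0) atTop V} with hA
  have hAo : IsOpen A := by
    rw [isOpen_iff_mem_nhds]
    rintro z ⟨V, hV, hVu⟩
    filter_upwards [eventually_mem_nhds_iff.2 hV] with w hw using ⟨V, hw, hVu⟩
  refine hUc.subset_of_closure_inter_subset hAo ⟨z₁, hz₁, h₁⟩ ?_
  rintro z ⟨hzA, hzU⟩
  obtain ⟨C, V₀, hV₀, hC⟩ := hb z hzU
  obtain ⟨R, hR, hRs⟩ := nhds_basis_closedBall.mem_iff.1 (inter_mem (hU.mem_nhds hzU) hV₀)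
  -- For every `w` in `ball z r`, the ball of radius `2 * r` about `w` contains `ball z r` and lies
  -- in `closedBall z R`.
  set r := R / 3 with hr
  have hr0 : 0 < r := by positivity
  obtain ⟨z', hz', V', hV', hVu⟩ := mem_closure_iff_nhds.1 hzA (ball z r) (ball_mem_nhds z hr0)
  obtain ⟨s, hs, hsV⟩ := nhds_basis_closedBall.mem_iff.1
    (inter_mem (isOpen_ball.mem_nhds hz') hV')
  refine ⟨ball z r, ball_mem_nhds z hr0, ?_⟩
  rw [Metric.tendstoUniformlyOn_iff]
  intro ε hε
  have hvs : volume (closedBall z' s) ≠ 0 := (measure_closedBall_pos _ _ hs).ne'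
  have hv2 : volume (closedBall (0 : Fin m → ℂ) (2 * r)) * negLog C ε ≠ ⊤ := by
    rw [negLog_of_ne hε.ne']
    exact ENNReal.mul_ne_top measure_closedBall_lt_top.ne ENNReal.ofReal_ne_top
  -- If `|F k| ≤ e^(C - M)` on the small ball, then `C - log |F k| ≥ M` there. This `M` makes the
  -- resulting mass exceed what the mean value inequality permits at a centre `w` with `|F k w| ≥
  -- ε`.
  obtain ⟨M, hM⟩ := ENNReal.exists_nat_mul_gt hvs hv2
  have hδ : 0 < Real.exp (C - M) := Real.exp_pos _
  filter_upwards [Metric.tendstoUniformlyOn_iff.1 hVu _ hδ] with k hk w hw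
  by_contra! hwε
  rw [dist_zero_left] at hwε
  have hwball : closedBall w (2 * r) ⊆ closedBall z R := by
    refine closedBall_subset_closedBall' ?_
    have : dist w z < r := hw
    linarith
  have hsub : closedBall z' s ⊆ closedBall w (2 * r) := by
    intro x hx
    have h1 : dist x z < r := (hsV hx).1
    have h2 : dist w z < r := hw
    rw [mem_closedBall]
    linarith [dist_triangle_right x w z]
  have key := volume_mul_negLog_le hU (hF k) (hFm k) (C := C)
    (hwball.trans fun x hx => (hRs hx).1) (norm_pos_iff.1 (hε.trans_le hwε))
    (fun x hx => (hC k x (hRs (hwball hx)).2).trans (by linarith [Real.add_one_le_exp C]))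
    measurableSet_closedBall hsub (δ := Real.exp (C - M)) (fun x hx => by
      have := hk x (hsV hx).2
      rw [dist_zero_left] at this
      exact this.le)
  rw [negLog_of_ne hδ.ne', Real.log_exp, sub_sub_cancel, ENNReal.ofReal_natCast] at key
  refine absurd (key.trans (mul_le_mul_right (negLog_anti hε.le hwε) _)) (not_le.2 ?_)
  rwa [mul_comm (volume (closedBall z' s))]

/-- Uniform local integrability of `log |F i|` for a locally bounded family of holomorphic
functions which is nowhere locally close to zero. -/
theorem exists_setLIntegral_negLog_le {ι : Type*} {F : ι → (Fin m → ℂ) → ℂ} (hU : IsOpen U)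
    (hF : ∀ i, DifferentiableOn ℂ (F i) U) (hFm : ∀ i, Measurable (F i)) {C : ℝ}
    (hC : ∀ i, ∀ z ∈ U, ‖F i z‖ ≤ Real.exp C)
    (hne : ∀ z ∈ U, ∀ V ∈ 𝓝 z, ∃ c > 0, ∀ i, ∃ w ∈ V, c ≤ ‖F i w‖)
    {S : Set (Fin m → ℂ)} (hS : IsCompact S) (hSU : S ⊆ U) :
    ∃ B : ℝ≥0, ∀ i, ∫⁻ z in S, negLog C ‖F i z‖ ≤ B := by
  refine hS.induction_on (p := fun S => ∃ B : ℝ≥0, ∀ i, ∫⁻ z in S, negLog C ‖F i z‖ ≤ B)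
    ⟨0, by simp⟩ ?_ ?_ ?_
  · rintro s t hst ⟨B, hB⟩
    exact ⟨B, fun i => (lintegral_mono_set hst).trans (hB i)⟩
  · rintro s t ⟨B, hB⟩ ⟨B', hB'⟩
    refine ⟨B + B', fun i => (lintegral_union_le _ _ _).trans ?_⟩
    rw [ENNReal.coe_add]
    exact add_le_add (hB i) (hB' i)
  · intro z hz
    obtain ⟨R, hR, hRs⟩ := nhds_basis_closedBall.mem_iff.1 (hU.mem_nhds (hSU hz))
    set r := R / 3 with hr
    have hr0 : 0 < r := by positivity
    obtain ⟨c, hc, hcw⟩ := hne z (hSU hz) (ball z r) (ball_mem_nhds z hr0)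
    have hfin : volume (closedBall (0 : Fin m → ℂ) (2 * r)) * negLog C c ≠ ⊤ := by
      rw [negLog_of_ne hc.ne']
      exact ENNReal.mul_ne_top measure_closedBall_lt_top.ne ENNReal.ofReal_ne_top
    refine ⟨ball z r, mem_nhdsWithin_of_mem_nhds (ball_mem_nhds z hr0), _, fun i =>
      le_of_le_of_eq ?_ (ENNReal.coe_toNNReal hfin).symm⟩
    -- The centre depends on `i`, but the ball of radius `2 * r` about it always covers `ball z r`,
    -- so the bound does not.
    obtain ⟨w, hw, hcwi⟩ := hcw i
    have hwball : closedBall w (2 * r) ⊆ U := by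
      refine (closedBall_subset_closedBall' ?_).trans hRs
      have : dist w z < r := hw
      linarith
    have hsub : ball z r ⊆ closedBall w (2 * r) := by
      intro x hx
      have h1 : dist x z < r := hx
      have h2 : dist w z < r := hw
      rw [mem_closedBall]
      linarith [dist_triangle_right x w z]
    refine (lintegral_mono_set hsub).trans
      ((setLIntegral_closedBall_negLog_le hU (hF i) (hFm i) hwball
        (norm_pos_iff.1 (hc.trans_le hcwi)) fun x hx => hC i x (hwball hx)).trans ?_)
    gcongr
    exact negLog_anti hc.le hcwi

theorem exists_setLIntegral_negLog_sub_le {ι : Type*} {F : ι → (Fin m → ℂ) → ℂ} (hU : IsOpen U)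
    (hF : ∀ i, DifferentiableOn ℂ (F i) U) (hFm : ∀ i, Measurable (F i)) {C : ℝ}
    (hC : ∀ i, ∀ z ∈ U, ‖F i z‖ ≤ Real.exp C)
    (hne : ∀ z ∈ U, ∀ V ∈ 𝓝 z, ∃ c > 0, ∀ i, ∃ w ∈ V, c ≤ ‖F i w‖)
    {S : Set (Fin m → ℂ)} (hS : IsCompact S) (hSU : S ⊆ U) {ε : ℝ≥0} (hε : 0 < ε) :
    ∃ N : ℝ≥0, ∀ i, ∫⁻ z in S, (negLog C ‖F i z‖ - N) ≤ ε := by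
  obtain ⟨R, hR, hRU⟩ := hS.exists_cthickening_subset_open hU hSU
  obtain ⟨B, hB⟩ := exists_setLIntegral_negLog_le hU hF hFm hC hne hS.cthickening hRU
  refine exists_lintegral_sub_le (fun i => (measurable_negLog C).comp (hFm i).norm) hR hS hB ?_ hε
  intro i z r hr hz
  have hz0 : F i z ≠ 0 := by
    rintro h0
    simp [h0, negLog] at hz
  exact setLIntegral_closedBall_negLog_le hU (hF i) (hFm i) (hr.trans hRU) hz0
    fun w hw => hC i w (hRU (hr hw))

end Growth

/-! ### Local integrability of `log |f|` -/

section Integrability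

variable {m : ℕ}

theorem ae_ne_zero_of_setLIntegral_negLog_ne_top {f : (Fin m → ℂ) → ℂ} (hfm : Measurable f) {C : ℝ}
    {S : Set (Fin m → ℂ)} (hB : ∫⁻ z in S, negLog C ‖f z‖ ≠ ⊤) :
    ∀ᵐ z ∂(volume.restrict S), f z ≠ 0 := by
  filter_upwards [ae_lt_top ((measurable_negLog C).comp hfm.norm) hB] with z hz h0
  simp [h0, negLog] at hz

theorem integrableOn_log_norm {f : (Fin m → ℂ) → ℂ} (hfm : Measurable f) {C : ℝ}
    {S : Set (Fin m → ℂ)} (hS : MeasurableSet S) (hSf : volume S ≠ ⊤)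
    (hC : ∀ z ∈ S, ‖f z‖ ≤ Real.exp C) (hB : ∫⁻ z in S, negLog C ‖f z‖ ≠ ⊤) :
    IntegrableOn (fun z => Real.log ‖f z‖) S := by
  have h1 : Integrable (fun z => (negLog C ‖f z‖).toReal) (volume.restrict S) :=
    integrable_toReal_of_lintegral_ne_top ((measurable_negLog C).comp hfm.norm).aemeasurable hB
  have h2 : IntegrableOn (fun _ : Fin m → ℂ => C) S := integrableOn_const hSf
  refine (h2.sub h1).congr ?_
  filter_upwards [ae_ne_zero_of_setLIntegral_negLog_ne_top hfm hB, ae_restrict_mem hS] with z hz hzS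
  have hz' : ‖f z‖ ≠ 0 := by simpa using hz
  simp only [Pi.sub_apply]
  rw [negLog_of_ne hz', ENNReal.toReal_ofReal, sub_sub_cancel]
  exact sub_nonneg.2 (log_le_of_norm_le (norm_nonneg _) hz' (hC z hzS))

theorem exists_norm_le_exp {U : Set (Fin m → ℂ)} {f : (Fin m → ℂ) → ℂ} (hU : IsOpen U)
    (hf : ContinuousOn f U) {z : Fin m → ℂ} (hz : z ∈ U) :
    ∃ R > 0, closedBall z R ⊆ U ∧ ∃ C : ℝ, ∀ w ∈ closedBall z R, ‖f w‖ ≤ Real.exp C := by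
  obtain ⟨R, hR, hRU⟩ := nhds_basis_closedBall.mem_iff.1 (hU.mem_nhds hz)
  obtain ⟨C, hC⟩ := (isCompact_closedBall z R).exists_bound_of_continuousOn (hf.mono hRU)
  exact ⟨R, hR, hRU, C, fun w hw => (hC w hw).trans (by linarith [Real.add_one_le_exp C])⟩

/-- The identity theorem, obtained from propagation of smallness for the constant sequence `f`. -/
theorem exists_norm_pos_of_nhds {U : Set (Fin m → ℂ)} {f : (Fin m → ℂ) → ℂ} (hU : IsOpen U)
    (hUc : IsPreconnected U) (hf : DifferentiableOn ℂ f U) (hfm : Measurable f)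
    (hf0 : ∃ z ∈ U, f z ≠ 0) {z : Fin m → ℂ} (hz : z ∈ U) {V : Set (Fin m → ℂ)} (hV : V ∈ 𝓝 z) :
    ∃ w ∈ V, f w ≠ 0 := by
  by_contra! h
  obtain ⟨z₀, hz₀, hfz₀⟩ := hf0
  obtain ⟨W, hW, hWu⟩ := exists_nhds_tendstoUniformlyOn_zero (F := fun _ : ℕ => f) hU hUc
    (fun _ => hf) (fun _ => hfm) (fun w hw => by
      obtain ⟨R, hR, -, C, hC⟩ := exists_norm_le_exp hU hf.continuousOn hw
      exact ⟨_, _, closedBall_mem_nhds w hR, fun _ => hC⟩) hz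
    ⟨V, hV, by
      rw [Metric.tendstoUniformlyOn_iff]
      intro ε hε
      exact Eventually.of_forall fun n w hw => by simpa [h w hw] using hε⟩ z₀ hz₀
  have := hWu.tendsto_at (mem_of_mem_nhds hW)
  exact hfz₀ (tendsto_nhds_unique tendsto_const_nhds this)

/-- `log |f|` is locally integrable, and `f` is almost everywhere nonzero, near each point. -/
theorem exists_nhds_integrableOn_log_norm {U : Set (Fin m → ℂ)} {f : (Fin m → ℂ) → ℂ}
    (hU : IsOpen U) (hUc : IsPreconnected U) (hf : DifferentiableOn ℂ f U) (hfm : Measurable f)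
    (hf0 : ∃ z ∈ U, f z ≠ 0) {z : Fin m → ℂ} (hz : z ∈ U) :
    ∃ V ∈ 𝓝 z, IntegrableOn (fun z => Real.log ‖f z‖) V ∧
      ∀ᵐ z ∂(volume.restrict V), f z ≠ 0 := by
  obtain ⟨R, hR, hRU, C, hC⟩ := exists_norm_le_exp hU hf.continuousOn hz
  obtain ⟨B, hB⟩ := exists_setLIntegral_negLog_le (F := fun _ : Unit => f) (isOpen_ball (x := z))
    (fun _ => hf.mono (ball_subset_closedBall.trans hRU)) (fun _ => hfm)
    (fun _ w hw => hC w (ball_subset_closedBall hw)) (fun w hw V hV => by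
      obtain ⟨x, hx, hfx⟩ := exists_norm_pos_of_nhds hU hUc hf hfm hf0
        (hRU (ball_subset_closedBall hw)) hV
      exact ⟨‖f x‖, norm_pos_iff.2 hfx, fun _ => ⟨x, hx, le_rfl⟩⟩)
    (isCompact_closedBall z (R / 2)) (closedBall_subset_ball (by linarith))
  have hfin := ne_top_of_le_ne_top ENNReal.coe_ne_top (hB ())
  exact ⟨closedBall z (R / 2), closedBall_mem_nhds z (by linarith),
    integrableOn_log_norm hfm measurableSet_closedBall measure_closedBall_lt_top.ne
      (fun w hw => hC w (closedBall_subset_closedBall (by linarith) hw)) hfin,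
    ae_ne_zero_of_setLIntegral_negLog_ne_top hfm hfin⟩

theorem locallyIntegrableOn_log_norm {U : Set (Fin m → ℂ)} {f : (Fin m → ℂ) → ℂ}
    (hU : IsOpen U) (hUc : IsPreconnected U) (hf : DifferentiableOn ℂ f U) (hfm : Measurable f)
    (hf0 : ∃ z ∈ U, f z ≠ 0) : LocallyIntegrableOn (fun z => Real.log ‖f z‖) U := by
  intro z hz
  obtain ⟨V, hV, hVi, -⟩ := exists_nhds_integrableOn_log_norm hU hUc hf hfm hf0 hz
  exact ⟨V, mem_nhdsWithin_of_mem_nhds hV, hVi⟩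

theorem ae_ne_zero_of_differentiableOn {U : Set (Fin m → ℂ)} {f : (Fin m → ℂ) → ℂ}
    (hU : IsOpen U) (hUc : IsPreconnected U) (hf : DifferentiableOn ℂ f U) (hfm : Measurable f)
    (hf0 : ∃ z ∈ U, f z ≠ 0) : ∀ᵐ z, z ∈ U → f z ≠ 0 := by
  have hnull : volume (U ∩ f ⁻¹' {0}) = 0 := by
    refine measure_null_of_locally_null _ fun z hz => ?_
    obtain ⟨V, hV, -, hVa⟩ := exists_nhds_integrableOn_log_norm hU hUc hf hfm hf0 hz.1
    refine ⟨V ∩ (U ∩ f ⁻¹' {0}), inter_mem (mem_nhdsWithin_of_mem_nhds hV) self_mem_nhdsWithin, ?_⟩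
    have h1 : volume.restrict V (f ⁻¹' {0}) = 0 := by
      rw [ae_iff] at hVa
      simpa using! hVa
    rw [Measure.restrict_apply (hfm (measurableSet_singleton 0))] at h1
    exact measure_mono_null (t := f ⁻¹' {0} ∩ V) (fun w hw => ⟨hw.2.2, hw.1⟩) h1
  rw [ae_iff]
  convert hnull using 2
  ext z
  simp

end Integrability

/-! ### Geometry of tubes -/

section Tube

variable {m : ℕ}

/-- The real part `x` of `z = x + iy`. -/
def reVec (z : Fin m → ℂ) : Fin m → ℝ := fun j => (z j).re

/-- The point `iy`. -/
def imagVec (y : Fin m → ℝ) : Fin m → ℂ := fun j => (y j : ℂ) * Complex.I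

theorem continuous_realVec : Continuous (realVec : (Fin m → ℝ) → Fin m → ℂ) :=
  continuous_pi fun j => Complex.continuous_ofReal.comp (continuous_apply j)

theorem continuous_imagVec : Continuous (imagVec : (Fin m → ℝ) → Fin m → ℂ) :=
  continuous_pi fun j => (Complex.continuous_ofReal.comp (continuous_apply j)).mul continuous_const

theorem realVec_add (s t : Fin m → ℝ) : realVec (s + t) = realVec s + realVec t := by
  funext j
  simp [realVec]

theorem imVec_add_realVec (z : Fin m → ℂ) (t : Fin m → ℝ) : imVec (z + realVec t) = imVec z := by
  funext j
  simp [imVec, realVec]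

theorem imVec_imagVec (y : Fin m → ℝ) : imVec (imagVec y) = y := by
  funext j
  simp [imVec, imagVec]

theorem imagVec_add_realVec (z : Fin m → ℂ) : imagVec (imVec z) + realVec (reVec z) = z := by
  funext j
  simp only [imagVec, imVec, realVec, reVec, Pi.add_apply]
  rw [add_comm]
  exact Complex.re_add_im (z j)

theorem add_realVec_mem_tube {S : Set (Fin m → ℝ)} {z : Fin m → ℂ} (t : Fin m → ℝ) :
    z + realVec t ∈ tube S ↔ z ∈ tube S := by
  simp [tube, imVec_add_realVec]

theorem sub_realVec_mem_tube {S : Set (Fin m → ℝ)} {z : Fin m → ℂ} (t : Fin m → ℝ) :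
    z - realVec t ∈ tube S ↔ z ∈ tube S := by
  simp [tube, imVec_sub_realVec]

theorem isOpen_tube {S : Set (Fin m → ℝ)} (hS : IsOpen S) : IsOpen (tube S) :=
  hS.preimage continuous_imVec

theorem isPreconnected_tube {S : Set (Fin m → ℝ)} (hS : IsPreconnected S) :
    IsPreconnected (tube S) := by
  have h : tube S = (fun p : (Fin m → ℝ) × (Fin m → ℝ) => imagVec p.2 + realVec p.1) ''
      (univ ×ˢ S) := by
    ext z
    constructor
    · intro hz
      exact ⟨(reVec z, imVec z), ⟨mem_univ _, hz⟩, imagVec_add_realVec z⟩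
    · rintro ⟨p, hp, rfl⟩
      rw [add_realVec_mem_tube]
      simpa [tube, imVec_imagVec] using hp
  rw [h]
  refine (isPreconnected_univ.prod hS).image _ (Continuous.continuousOn ?_)
  exact (continuous_imagVec.comp continuous_snd).add (continuous_realVec.comp continuous_fst)

theorem tube_mono {S T : Set (Fin m → ℝ)} (h : S ⊆ T) : tube S ⊆ tube T := fun _ hz => h hz

theorem differentiableOn_comp_add_realVec {S : Set (Fin m → ℝ)} {f : (Fin m → ℂ) → ℂ}
    (hf : DifferentiableOn ℂ f (tube S)) (t : Fin m → ℝ) :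
    DifferentiableOn ℂ (fun z => f (z + realVec t)) (tube S) :=
  hf.comp (differentiableOn_id.add_const _) fun _ hz => (add_realVec_mem_tube t).2 hz

/-- An almost periodic function on a tube set with compact base is bounded. -/
theorem IsAPOnTubeSet.exists_norm_le {E : Type*} [NormedAddCommGroup E] {K : Set (Fin m → ℝ)}
    (hK : IsCompact K) {u : (Fin m → ℂ) → E} (hu : IsAPOnTubeSet K u) :
    ∃ C : ℝ, ∀ z ∈ tube K, ‖u z‖ ≤ C := by
  by_contra! h
  choose z hz hzn using fun n : ℕ => h n
  -- Shifting by the real parts brings the points `z n` back to the compact set `iK`. There one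
  -- fixed translate is bounded, and uniform convergence keeps all later ones within 2 of it.
  obtain ⟨k, hk, g, hg⟩ := hu.2 fun n => reVec (z n)
  obtain ⟨N, hN⟩ := eventually_atTop.1 (Metric.tendstoUniformlyOn_iff.1 hg 1 one_pos)
  have hcomp : IsCompact ((fun y => imagVec y + realVec (reVec (z (k N)))) '' K) :=
    hK.image (continuous_imagVec.add continuous_const)
  obtain ⟨C, hC⟩ := hcomp.exists_bound_of_continuousOn (hu.1.mono (by
    rintro _ ⟨y, hy, rfl⟩
    rw [add_realVec_mem_tube]
    simpa [tube, imVec_imagVec] using hy))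
  obtain ⟨n, hn⟩ := exists_nat_gt (C + 2)
  set p := max n N with hp
  have hmem : imagVec (imVec (z (k p))) ∈ tube K := by
    simpa [tube, imVec_imagVec] using hz (k p)
  have h1 := hN p (le_max_right _ _) _ hmem
  have h2 := hN N le_rfl _ hmem
  have h3 := hC _ ⟨imVec (z (k p)), hz (k p), rfl⟩
  have h4 := hzn (k p)
  rw [imagVec_add_realVec] at h1
  have h5 : (n : ℝ) ≤ k p := by exact_mod_cast (le_max_left n N).trans (hk.id_le p)
  rw [dist_eq_norm] at h1 h2
  have h6 := norm_sub_norm_le (u (z (k p))) (g (imagVec (imVec (z (k p)))))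
  have h7 := norm_sub_norm_le (g (imagVec (imVec (z (k p)))))
    (u (imagVec (imVec (z (k p))) + realVec (reVec (z (k N)))))
  rw [norm_sub_rev] at h6
  linarith

end Tube

/-! ### Pairings with translated test functions -/

section Smoothing

variable {m : ℕ} {Ω : Opens (Fin m → ℝ)}

theorem translate_apply (t : Fin m → ℝ) (φ : 𝓓(openTube Ω, ℝ)) (z : Fin m → ℂ) :
    translate t φ z = φ (z - realVec t) := rfl

theorem regularDistribution_translate {u : (Fin m → ℂ) → ℝ}
    (hu : LocallyIntegrableOn u (openTube Ω : Set (Fin m → ℂ))) (t : Fin m → ℝ)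
    (φ : 𝓓(openTube Ω, ℝ)) :
    regularDistribution (openTube Ω) u (translate t φ) = ∫ z, φ z * u (z + realVec t) := by
  rw [regularDistribution_apply hu, ← integral_add_right_eq_self _ (realVec t)]
  simp only [translate_apply, add_sub_cancel_right]

theorem integrable_mul_comp_add_realVec {u : (Fin m → ℂ) → ℝ}
    (hu : LocallyIntegrableOn u (openTube Ω : Set (Fin m → ℂ))) (t : Fin m → ℝ)
    (φ : 𝓓(openTube Ω, ℝ)) : Integrable fun z => φ z * u (z + realVec t) := by
  have h := (translate t φ).integrable_bilin (ContinuousLinearMap.mul ℝ ℝ) hu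
  simpa [translate_apply] using h.comp_add_right (realVec t)

/-- Dominated convergence: for `t` near `t₀` all translates of `φ` live on one compact subset of the
tube, where `u` is integrable. -/
theorem continuous_regularDistribution_translate {u : (Fin m → ℂ) → ℝ}
    (hu : LocallyIntegrableOn u (openTube Ω : Set (Fin m → ℂ))) (φ : 𝓓(openTube Ω, ℝ)) :
    Continuous fun t => regularDistribution (openTube Ω) u (translate t φ) := by
  simp only [regularDistribution_apply hu, translate_apply]
  rw [continuous_iff_continuousAt]
  intro t₀
  obtain ⟨M, hM⟩ := φ.continuous.bounded_above_of_compact_support φ.hasCompactSupport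
  have hKc : IsCompact ((fun p : (Fin m → ℂ) × (Fin m → ℝ) => p.1 + realVec p.2) ''
      (tsupport φ ×ˢ closedBall t₀ 1)) :=
    (IsCompact.prod φ.hasCompactSupport (isCompact_closedBall t₀ 1)).image
      (continuous_fst.add (continuous_realVec.comp continuous_snd))
  set K := (fun p : (Fin m → ℂ) × (Fin m → ℝ) => p.1 + realVec p.2) ''
      (tsupport φ ×ˢ closedBall t₀ 1) with hK
  have hKU : K ⊆ (openTube Ω : Set (Fin m → ℂ)) := by
    rintro _ ⟨p, hp, rfl⟩
    exact (add_realVec_mem_tube _).2 (φ.tsupport_subset hp.1)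
  have huK : IntegrableOn u K := hu.integrableOn_compact_subset hKU hKc
  have hsupp : ∀ t ∈ closedBall t₀ 1, ∀ z, z ∉ K → φ (z - realVec t) = 0 := by
    intro t ht z hz
    refine image_eq_zero_of_notMem_tsupport fun h => hz ?_
    exact ⟨(z - realVec t, t), ⟨h, ht⟩, sub_add_cancel _ _⟩
  have hev : ∀ᶠ t in 𝓝 t₀, t ∈ closedBall t₀ 1 := closedBall_mem_nhds t₀ one_pos
  refine continuousAt_of_dominated (bound := K.indicator fun z => M * ‖u z‖) ?_ ?_ ?_ ?_
  · refine Eventually.of_forall fun t => ?_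
    exact ((translate t φ).integrable_bilin (ContinuousLinearMap.mul ℝ ℝ) hu).aestronglyMeasurable
  · filter_upwards [hev] with t ht
    refine Eventually.of_forall fun z => ?_
    by_cases hz : z ∈ K
    · rw [indicator_of_mem hz, norm_mul]
      gcongr
      exact hM _
    · simp [hsupp t ht z hz, hz]
  · exact (integrable_indicator_iff hKc.measurableSet).2 (huK.norm.const_mul M)
  · refine Eventually.of_forall fun z => Continuous.continuousAt ?_
    exact (φ.continuous.comp (continuous_const.sub continuous_realVec)).mul continuous_const

end Smoothing

/-! ### Truncated logarithms -/

theorem abs_min_sub_min_le {C N x y : ℝ} (hx : 0 < x) (hy : 0 < y) :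
    |min (C - Real.log x) N - min (C - Real.log y) N| ≤ |x - y| * Real.exp (N - C) := by
  wlog h : x ≤ y generalizing x y
  · rw [abs_sub_comm, abs_sub_comm x]
    exact this hy hx (le_of_not_ge h)
  have hlog : Real.log x ≤ Real.log y := Real.log_le_log hx h
  rw [abs_of_nonneg (sub_nonneg.2 (min_le_min_right N (by linarith))), abs_sub_comm,
    abs_of_nonneg (sub_nonneg.2 h)]
  by_cases hy' : C - Real.log y ≤ N
  swap
  · rw [min_eq_right (by linarith), min_eq_right (by linarith), sub_self]
    exact mul_nonneg (by linarith) (Real.exp_pos _).le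
  rw [min_eq_left hy']
  -- The truncation is active exactly below `η`. Replacing `x` by `max x η` leaves an interval on
  -- which `log` has slope at most `1/η`.
  set η := Real.exp (C - N) with hη
  have hη0 : 0 < η := Real.exp_pos _
  have hηinv : Real.exp (N - C) = η⁻¹ := by rw [hη, ← Real.exp_neg]; congr 1; ring
  have hyη : η ≤ y := by
    rw [← Real.exp_log hy, hη]
    exact Real.exp_le_exp.2 (by linarith)
  set x' := max x η with hx'
  have hx'0 : 0 < x' := lt_max_of_lt_left hx
  have hx'y : x' ≤ y := max_le h hyη
  have h1 : min (C - Real.log x) N ≤ C - Real.log x' := by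
    rcases le_total x η with h' | h'
    · rw [hx', max_eq_right h', hη, Real.log_exp]
      exact (min_le_right _ _).trans (by linarith)
    · rw [hx', max_eq_left h']
      exact min_le_left _ _
  have h2 : Real.log y - Real.log x' ≤ (y - x') / x' := by
    rw [← Real.log_div (hx'0.trans_le hx'y).ne' hx'0.ne', sub_div, div_self hx'0.ne']
    exact Real.log_le_sub_one_of_pos (div_pos (hx'0.trans_le hx'y) hx'0)
  have h3 : (y - x') / x' ≤ (y - x) * η⁻¹ := by
    rw [div_eq_mul_inv]
    have : x ≤ x' := le_max_left _ _
    have h4 : η ≤ x' := le_max_right _ _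
    gcongr
  rw [hηinv]
  linarith

theorem enorm_log_sub_log_le {C N x y : ℝ} (hx : 0 < x) (hy : 0 < y) (hN : 0 ≤ N) :
    ‖Real.log x - Real.log y‖ₑ ≤ (negLog C x - ENNReal.ofReal N) +
      (negLog C y - ENNReal.ofReal N) + ENNReal.ofReal (|x - y| * Real.exp (N - C)) := by
  have h := abs_min_sub_min_le (C := C) (N := N) hx hy
  rw [negLog_of_ne hx.ne', negLog_of_ne hy.ne', ← ENNReal.ofReal_sub _ hN,
    ← ENNReal.ofReal_sub _ hN, ← ofReal_norm, Real.norm_eq_abs]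
  have hsub : ∀ a : ℝ, a - min a N = max (a - N) 0 := by
    intro a
    rcases le_total a N with h | h
    · rw [min_eq_left h, max_eq_right (by linarith), sub_self]
    · rw [min_eq_right h, max_eq_left (by linarith)]
  have hmax : ∀ a : ℝ, ENNReal.ofReal a = ENNReal.ofReal (max a 0) := by
    intro a
    rcases le_total a 0 with h | h
    · rw [max_eq_right h, ENNReal.ofReal_zero, ENNReal.ofReal_eq_zero.2 h]
    · rw [max_eq_left h]
  rw [hmax (C - Real.log x - N), hmax (C - Real.log y - N),
    ← ENNReal.ofReal_add (le_max_right _ _) (le_max_right _ _),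
    ← ENNReal.ofReal_add (by positivity) (by positivity)]
  refine ENNReal.ofReal_le_ofReal ?_
  have h1 := hsub (C - Real.log x)
  have h2 := hsub (C - Real.log y)
  rw [abs_le] at h ⊢
  have h3 : 0 ≤ max (C - Real.log x - N) 0 := le_max_right _ _
  have h4 : 0 ≤ max (C - Real.log y - N) 0 := le_max_right _ _
  constructor <;> linarith [h.1, h.2]

/-! ### Almost periodic modulus implies almost periodic `log |f|` -/

section Forward

variable {m : ℕ} {Ω : Opens (Fin m → ℝ)}

/-- The translates of a holomorphic function with almost periodic modulus stay away from zero. -/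
theorem exists_le_norm_of_isAPOnTubeDomain (hΩ : IsPreconnected (Ω : Set (Fin m → ℝ)))
    {f : (Fin m → ℂ) → ℂ} (hf : DifferentiableOn ℂ f (tube (Ω : Set (Fin m → ℝ))))
    (hfm : Measurable f) (hf0 : ∃ z ∈ tube (Ω : Set (Fin m → ℝ)), f z ≠ 0)
    (hap : IsAPOnTubeDomain Ω fun z => ‖f z‖) {z : Fin m → ℂ}
    (hz : z ∈ tube (Ω : Set (Fin m → ℝ))) {V : Set (Fin m → ℂ)} (hV : V ∈ 𝓝 z) :
    ∃ c > 0, ∀ a : Fin m → ℝ, ∃ w ∈ V, c ≤ ‖f (w + realVec a)‖ := by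
  by_contra! h
  obtain ⟨z₀, hz₀, hfz₀⟩ := hf0
  choose a ha using fun n : ℕ => h (1 / (n + 1 : ℝ)) Nat.one_div_pos_of_nat
  -- A single horizontal plane suffices: uniformity over all of it is what permits evaluation at the
  -- moving points `z₀ - realVec (a (k n))`.
  obtain ⟨k, hk, g, hg⟩ := (hap.2 {imVec z₀} isCompact_singleton (by simpa using! hz₀)).2 a
  have hprop := exists_nhds_tendstoUniformlyOn_zero
    (F := fun n w => f (w + realVec (a (k n)))) (isOpen_tube Ω.isOpen) (isPreconnected_tube hΩ)
    (fun n => differentiableOn_comp_add_realVec hf _)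
    (fun n => hfm.comp (measurable_add_const _))
    (by
      intro w hw
      obtain ⟨K, hK, hKΩ⟩ := exists_compact_subset Ω.isOpen (show imVec w ∈ (Ω : Set _) from hw)
      obtain ⟨C, hC⟩ := (hap.2 K hK hKΩ.2).exists_norm_le hK
      refine ⟨C, tube K, ?_, fun n x hx => ?_⟩
      · exact mem_of_superset ((isOpen_tube isOpen_interior).mem_nhds hKΩ.1)
          (tube_mono interior_subset)
      · simpa using hC _ ((add_realVec_mem_tube (a (k n))).2 hx))
    hz ⟨V, hV, by
      rw [Metric.tendstoUniformlyOn_iff]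
      intro ε hε
      have h1 : Tendsto (fun n : ℕ => 1 / ((k n : ℝ) + 1)) atTop (𝓝 0) :=
        (tendsto_one_div_add_atTop_nhds_zero_nat (𝕜 := ℝ)).comp hk.tendsto_atTop
      filter_upwards [h1.eventually_lt_const hε] with n hn w hw
      rw [dist_zero_left]
      exact (ha (k n) w hw).trans hn⟩
  have hg0 : ∀ w ∈ tube {imVec z₀}, g w = 0 := by
    intro w hw
    have hwΩ : w ∈ tube (Ω : Set (Fin m → ℝ)) := by
      have : imVec w = imVec z₀ := hw
      change imVec w ∈ (Ω : Set (Fin m → ℝ))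
      rw [this]
      exact hz₀
    obtain ⟨W, hW, hWu⟩ := hprop w hwΩ
    have h1 := (hWu.tendsto_at (mem_of_mem_nhds hW)).norm
    have h2 := hg.tendsto_at hw
    rw [norm_zero] at h1
    exact tendsto_nhds_unique h2 h1
  obtain ⟨n, hn⟩ := (Metric.tendstoUniformlyOn_iff.1 hg _ (norm_pos_iff.2 hfz₀)).exists
  have hmem : z₀ - realVec (a (k n)) ∈ tube {imVec z₀} := (sub_realVec_mem_tube _).2 rfl
  have := hn _ hmem
  rw [hg0 _ hmem, sub_add_cancel, dist_zero_left, norm_norm] at this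
  exact lt_irrefl _ this

end Forward

section Forward

variable {m : ℕ} {Ω : Opens (Fin m → ℝ)}

/-- Each logarithm is cut at level `N`: the tails are small uniformly over all translates, and the
truncations differ by at most `e^(N - C)` times the difference of the moduli. -/
theorem exists_abs_integral_sub_le (hΩ : IsPreconnected (Ω : Set (Fin m → ℝ)))
    {f : (Fin m → ℂ) → ℂ} (hf : DifferentiableOn ℂ f (tube (Ω : Set (Fin m → ℝ))))
    (hfm : Measurable f) (hf0 : ∃ z ∈ tube (Ω : Set (Fin m → ℝ)), f z ≠ 0)
    (hap : IsAPOnTubeDomain Ω fun z => ‖f z‖) (φ : 𝓓(openTube Ω, ℝ)) {ε : ℝ} (hε : 0 < ε) :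
    ∃ δ > 0, ∀ a b : Fin m → ℝ,
      (∀ z ∈ tsupport φ, |‖f (z + realVec a)‖ - ‖f (z + realVec b)‖| ≤ δ) →
      |(∫ z, φ z * Real.log ‖f (z + realVec a)‖) - ∫ z, φ z * Real.log ‖f (z + realVec b)‖| ≤
        ε := by
  have hu := locallyIntegrableOn_log_norm (isOpen_tube Ω.isOpen) (isPreconnected_tube hΩ) hf hfm hf0
  have hne := ae_ne_zero_of_differentiableOn (isOpen_tube Ω.isOpen) (isPreconnected_tube hΩ) hf
    hfm hf0
  set S := tsupport φ with hS
  have hSc : IsCompact S := φ.hasCompactSupport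
  have hSΩ : imVec '' S ⊆ (Ω : Set (Fin m → ℝ)) := by
    rintro _ ⟨z, hz, rfl⟩
    exact φ.tsupport_subset hz
  obtain ⟨V, hVo, hKV, hVΩ, hVc⟩ := exists_open_between_and_isCompact_closure
    (hSc.image continuous_imVec) Ω.isOpen hSΩ
  have hVΩ' : V ⊆ (Ω : Set (Fin m → ℝ)) := subset_closure.trans hVΩ
  obtain ⟨C, hC⟩ := (hap.2 _ hVc hVΩ).exists_norm_le hVc
  have hSV : S ⊆ tube V := fun z hz => hKV ⟨z, hz, rfl⟩
  obtain ⟨M₀, hM₀⟩ := φ.continuous.bounded_above_of_compact_support φ.hasCompactSupport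
  set M : ℝ≥0 := Real.toNNReal M₀ + 1 with hM
  have hM0 : 0 < M := by positivity
  have hφM : ∀ z, ‖φ z‖ₑ ≤ M := by
    intro z
    rw [← ofReal_norm, ← ENNReal.ofReal_coe_nnreal]
    refine ENNReal.ofReal_le_ofReal ((hM₀ z).trans ?_)
    rw [hM, NNReal.coe_add, NNReal.coe_one]
    linarith [Real.le_coe_toNNReal M₀]
  set ε' : ℝ≥0 := Real.toNNReal ε with hε'
  have hε'0 : 0 < ε' := Real.toNNReal_pos.2 hε
  have hε'ε : (ε' : ℝ) = ε := Real.coe_toNNReal _ hε.le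
  obtain ⟨N, hN⟩ := exists_setLIntegral_negLog_sub_le
    (F := fun (a : Fin m → ℝ) z => f (z + realVec a)) (C := C) (isOpen_tube hVo)
    (fun a => differentiableOn_comp_add_realVec (hf.mono (tube_mono hVΩ')) a)
    (fun a => hfm.comp (measurable_add_const _))
    (fun a z hz => by
      have := hC (z + realVec a) ((add_realVec_mem_tube a).2 (subset_closure hz))
      rw [norm_norm] at this
      exact this.trans (by linarith [Real.add_one_le_exp C]))
    (fun z hz W hW => exists_le_norm_of_isAPOnTubeDomain hΩ hf hfm hf0 hap (hVΩ' hz) hW)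
    hSc hSV (ε := ε' / (4 * M)) (by positivity)
  set v : ℝ≥0 := (volume S).toNNReal with hv
  have hvS : (v : ℝ≥0∞) = volume S := ENNReal.coe_toNNReal hSc.measure_lt_top.ne
  set E : ℝ≥0 := ⟨Real.exp (N - C), (Real.exp_pos _).le⟩ with hE
  have hE0 : 0 < E := Real.exp_pos _
  -- Each of the two tails costs `ε' / 4`, and this `δ` limits the Lipschitz part to `ε' / 2`; the
  -- added ones in `M` and `v + 1` keep the denominators positive.
  set δ : ℝ≥0 := ε' / (2 * M * (v + 1) * E) with hδ
  have hδ0 : 0 < δ := by positivity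
  refine ⟨δ, by exact_mod_cast hδ0, fun a b hab => ?_⟩
  have hia := integrable_mul_comp_add_realVec hu a φ
  have hib := integrable_mul_comp_add_realVec hu b φ
  rw [← integral_sub hia hib, ← Real.norm_eq_abs, ← hε'ε]
  have hsum : M * (ε' / (4 * M) + ε' / (4 * M) + δ * E * v) ≤ ε' := by
    have h1 : M * (ε' / (4 * M)) = ε' / 4 := by field_simp
    have h2 : M * (δ * E * v) ≤ ε' / 2 := by
      have : M * (δ * E * v) = ε' / 2 * (v / (v + 1)) := by
        rw [hδ]
        field_simp
      rw [this]
      refine mul_le_of_le_one_right' ?_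
      exact div_le_one_of_le₀ le_self_add (by positivity)
    calc M * (ε' / (4 * M) + ε' / (4 * M) + δ * E * v)
        = ε' / 4 + ε' / 4 + M * (δ * E * v) := by rw [mul_add, mul_add, h1]
      _ ≤ ε' / 4 + ε' / 4 + ε' / 2 := by gcongr
      _ = ε' := by
        rw [← NNReal.coe_inj]
        push_cast
        ring
  have hnea : ∀ a : Fin m → ℝ, ∀ᵐ z, z + realVec a ∈ tube (Ω : Set (Fin m → ℝ)) →
      f (z + realVec a) ≠ 0 := fun a =>
    (measurePreserving_add_right volume (realVec a)).quasiMeasurePreserving.ae hne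
  have hmeas : ∀ a : Fin m → ℝ, Measurable fun z => negLog C ‖f (z + realVec a)‖ - N := fun a =>
    ((measurable_negLog C).comp (hfm.comp (measurable_add_const _)).norm).sub measurable_const
  have hlin : ∫⁻ z, ‖φ z * Real.log ‖f (z + realVec a)‖ - φ z * Real.log ‖f (z + realVec b)‖‖ₑ ≤
      ε' := by
    calc ∫⁻ z, ‖φ z * Real.log ‖f (z + realVec a)‖ - φ z * Real.log ‖f (z + realVec b)‖‖ₑ
        ≤ ∫⁻ z in S, M * ((negLog C ‖f (z + realVec a)‖ - N) +
            (negLog C ‖f (z + realVec b)‖ - N) + (δ * E : ℝ≥0)) := by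
          rw [← lintegral_indicator hSc.measurableSet]
          refine lintegral_mono_ae ?_
          filter_upwards [hnea a, hnea b] with z hza hzb
          by_cases hz : z ∈ S
          · have hzΩ : z ∈ tube (Ω : Set (Fin m → ℝ)) := φ.tsupport_subset hz
            have ha := hza ((add_realVec_mem_tube a).2 hzΩ)
            have hb := hzb ((add_realVec_mem_tube b).2 hzΩ)
            rw [indicator_of_mem hz, ← mul_sub, enorm_mul]
            gcongr
            · exact hφM z
            · refine (enorm_log_sub_log_le (C := C) (norm_pos_iff.2 ha) (norm_pos_iff.2 hb)
                N.coe_nonneg).trans ?_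
              rw [ENNReal.ofReal_coe_nnreal]
              gcongr
              rw [← ENNReal.ofReal_coe_nnreal]
              refine ENNReal.ofReal_le_ofReal ?_
              rw [NNReal.coe_mul]
              exact mul_le_mul_of_nonneg_right (hab z hz) (Real.exp_pos _).le
          · have : φ z = 0 := image_eq_zero_of_notMem_tsupport hz
            simp [this]
      _ = M * ((∫⁻ z in S, (negLog C ‖f (z + realVec a)‖ - N)) +
            (∫⁻ z in S, (negLog C ‖f (z + realVec b)‖ - N)) + (δ * E : ℝ≥0) * v) := by
          rw [lintegral_const_mul' _ _ ENNReal.coe_ne_top,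
            lintegral_add_right _ measurable_const, lintegral_add_right _ (hmeas b),
            setLIntegral_const, hvS]
      _ ≤ M * ((ε' / (4 * M) : ℝ≥0) + (ε' / (4 * M) : ℝ≥0) + (δ * E : ℝ≥0) * v) := by
          gcongr
          · exact hN a
          · exact hN b
      _ ≤ ε' := by exact_mod_cast hsum
  have := (enorm_integral_le_lintegral_enorm
    (fun z => φ z * Real.log ‖f (z + realVec a)‖ - φ z * Real.log ‖f (z + realVec b)‖)).trans hlin
  rw [← ofReal_norm, ← ENNReal.ofReal_coe_nnreal] at this
  exact (ENNReal.ofReal_le_ofReal_iff ε'.coe_nonneg).1 this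

/-- A uniformly Cauchy sequence of functions on a set converges uniformly. -/
theorem exists_tendstoUniformlyOn_of_dist_lt {α E : Type*} [MetricSpace E] [CompleteSpace E]
    {F : ℕ → α → E} {s : Set α}
    (h : ∀ ε > 0, ∃ N, ∀ n ≥ N, ∀ n' ≥ N, ∀ x ∈ s, dist (F n x) (F n' x) < ε) :
    ∃ g : α → E, TendstoUniformlyOn F g atTop s := by
  have hU : UniformCauchySeqOn F atTop s := Metric.uniformCauchySeqOn_iff.2 h
  have hlim : ∀ x : α, ∃ y : E, x ∈ s → Tendsto (fun n => F n x) atTop (𝓝 y) := by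
    intro x
    by_cases hx : x ∈ s
    · obtain ⟨y, hy⟩ := cauchySeq_tendsto_of_complete (hU.cauchySeq hx)
      exact ⟨y, fun _ => hy⟩
    · by_cases hne : Nonempty E
      · exact ⟨hne.some, fun h => absurd h hx⟩
      · exact ⟨F 0 x, fun h => absurd h hx⟩
  choose g hg using hlim
  exact ⟨g, hU.tendstoUniformlyOn_of_tendsto hg⟩

theorem isAPDistribution_of_isAPOnTubeDomain (hΩ : IsPreconnected (Ω : Set (Fin m → ℝ)))
    {f : (Fin m → ℂ) → ℂ} (hf : DifferentiableOn ℂ f (tube (Ω : Set (Fin m → ℝ))))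
    (hfm : Measurable f) (hf0 : ∃ z ∈ tube (Ω : Set (Fin m → ℝ)), f z ≠ 0)
    (hap : IsAPOnTubeDomain Ω fun z => ‖f z‖) :
    IsAPDistribution (regularDistribution (openTube Ω) fun z => Real.log ‖f z‖) := by
  intro φ
  have hu : LocallyIntegrableOn (fun z => Real.log ‖f z‖) (openTube Ω : Set (Fin m → ℂ)) :=
    locallyIntegrableOn_log_norm (isOpen_tube Ω.isOpen) (isPreconnected_tube hΩ) hf hfm hf0
  refine ⟨continuous_regularDistribution_translate hu φ, fun h => ?_⟩
  set K := imVec '' tsupport φ with hK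
  have hKΩ : K ⊆ (Ω : Set (Fin m → ℝ)) := by
    rintro _ ⟨z, hz, rfl⟩
    exact φ.tsupport_subset hz
  -- The subsequence chosen for `|f|` over the imaginary parts of the support of `φ` also serves for
  -- the pairings.
  obtain ⟨k, hk, g, hg⟩ := (hap.2 K (IsCompact.image φ.hasCompactSupport continuous_imVec) hKΩ).2 h
  refine ⟨k, hk, ?_⟩
  simp only [← tendstoUniformlyOn_univ]
  refine exists_tendstoUniformlyOn_of_dist_lt fun ε hε => ?_
  obtain ⟨δ, hδ, hδI⟩ := exists_abs_integral_sub_le hΩ hf hfm hf0 hap φ (half_pos hε)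
  obtain ⟨N, hN⟩ := Metric.uniformCauchySeqOn_iff.1 hg.uniformCauchySeqOn δ hδ
  refine ⟨N, fun n hn n' hn' t _ => ?_⟩
  rw [regularDistribution_translate hu, regularDistribution_translate hu, Real.dist_eq]
  refine (hδI _ _ fun z hz => ?_).trans_lt (half_lt_self hε)
  have hmem : z + realVec t ∈ tube K := (add_realVec_mem_tube t).2 ⟨z, hz, rfl⟩
  have := hN n hn n' hn' _ hmem
  rw [Real.dist_eq] at this
  rw [realVec_add, realVec_add, ← add_assoc, ← add_assoc]
  exact this.le

end Forward

theorem IsAPFunction.exists_norm_le {m : ℕ} {E : Type*} [NormedAddCommGroup E]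
    {u : (Fin m → ℝ) → E} (hu : IsAPFunction u) : ∃ C : ℝ, ∀ t, ‖u t‖ ≤ C := by
  by_contra! h
  choose t ht using fun n : ℕ => h n
  obtain ⟨k, hk, g, hg⟩ := hu.2 t
  have h1 := (hg.tendsto_at 0).norm
  refine not_tendsto_nhds_of_tendsto_atTop ?_ _ h1
  refine tendsto_atTop_mono (fun n => ?_) (tendsto_natCast_atTop_atTop (R := ℝ))
  rw [zero_add]
  have : (n : ℝ) ≤ k n := by exact_mod_cast hk.id_le n
  exact this.trans (ht (k n)).le

/-! ### Banach–Steinhaus for superposed test functions -/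

section Superposition

variable {m : ℕ} {Ω : Opens (Fin m → ℝ)}

theorem summable_superposition {ψ : (Fin m → ℂ) → ℝ} {M : ℝ} (hM : ∀ z, ‖ψ z‖ ≤ M)
    (w : ℕ → Fin m → ℂ) (b : ℕ →ᵇ ℝ) (z : Fin m → ℂ) :
    Summable fun j => ((1 / 2 : ℝ) ^ j * b j) * ψ (z - w j) := by
  refine Summable.of_norm_bounded (g := fun j => (1 / 2 : ℝ) ^ j * (‖b‖ * M))
    (summable_geometric_two.mul_right _) fun j => ?_
  rw [norm_mul, norm_mul, mul_assoc, Real.norm_of_nonneg (by positivity)]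
  gcongr
  · exact b.norm_coe_le_norm j
  · exact hM _

theorem norm_superposition_le {ψ : (Fin m → ℂ) → ℝ} {M : ℝ} (hM : ∀ z, ‖ψ z‖ ≤ M)
    (w : ℕ → Fin m → ℂ) (b : ℕ →ᵇ ℝ) (z : Fin m → ℂ) :
    ‖∑' j, ((1 / 2 : ℝ) ^ j * b j) * ψ (z - w j)‖ ≤ 2 * (‖b‖ * M) := by
  refine tsum_of_norm_bounded (g := fun j => (1 / 2 : ℝ) ^ j * (‖b‖ * M))
    (hasSum_geometric_two.mul_right _) fun j => ?_
  rw [norm_mul, norm_mul, mul_assoc, Real.norm_of_nonneg (by positivity)]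
  gcongr
  · exact b.norm_coe_le_norm j
  · exact hM _

theorem superposition_eq_zero {ψ : (Fin m → ℂ) → ℝ} {A : Set (Fin m → ℂ)} {w : ℕ → Fin m → ℂ}
    (hw : ∀ j, w j ∈ A) (b : ℕ →ᵇ ℝ) {z : Fin m → ℂ}
    (hz : z ∉ (fun p : (Fin m → ℂ) × (Fin m → ℂ) => p.1 + p.2) '' (tsupport ψ ×ˢ A)) :
    ∑' j, ((1 / 2 : ℝ) ^ j * b j) * ψ (z - w j) = 0 := by
  have : ∀ j, ψ (z - w j) = 0 := fun j => by
    refine image_eq_zero_of_notMem_tsupport fun h => hz ?_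
    exact ⟨(z - w j, w j), ⟨h, hw j⟩, sub_add_cancel _ _⟩
  simp [this]

theorem contDiff_superposition {ψ : (Fin m → ℂ) → ℝ} (hψ : ContDiff ℝ ∞ ψ)
    (hψc : HasCompactSupport ψ) (w : ℕ → Fin m → ℂ) (b : ℕ →ᵇ ℝ) :
    ContDiff ℝ ∞ fun z => ∑' j, ((1 / 2 : ℝ) ^ j * b j) * ψ (z - w j) := by
  have hbd : ∀ k : ℕ, ∃ M : ℝ, ∀ z, ‖iteratedFDeriv ℝ k ψ z‖ ≤ M := fun k =>
    (hψ.continuous_iteratedFDeriv (m := k) (by exact_mod_cast le_top)).bounded_above_of_compact_support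
      (hψc.iteratedFDeriv k)
  choose M hM using hbd
  have hsm : ∀ j, ContDiff ℝ ∞ fun z => ψ (z - w j) := fun j =>
    hψ.comp (contDiff_id.sub contDiff_const)
  refine contDiff_tsum (N := ⊤) (v := fun k j => (1 / 2 : ℝ) ^ j * (‖b‖ * M k))
    (fun j => contDiff_const.mul (hsm j)) (fun k _ => summable_geometric_two.mul_right _) ?_
  intro k j z _
  have h1 : iteratedFDeriv ℝ k (fun z => ((1 / 2 : ℝ) ^ j * b j) * ψ (z - w j)) z =
      ((1 / 2 : ℝ) ^ j * b j) • iteratedFDeriv ℝ k ψ (z - w j) := by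
    have := iteratedFDeriv_const_smul_apply (𝕜 := ℝ) (i := k) (a := ((1 / 2 : ℝ) ^ j * b j))
      (f := fun z => ψ (z - w j)) (x := z)
      ((hsm j).contDiffAt.of_le (by exact_mod_cast le_top))
    rw [← iteratedFDeriv_comp_sub]
    exact this
  rw [h1, norm_smul, norm_mul, mul_assoc, Real.norm_of_nonneg (by positivity)]
  gcongr
  · exact b.norm_coe_le_norm j
  · exact hM _ _

/-- The test function `∑ j, 2⁻ʲ b j ψ (z - w j)`. -/
def superposition {ψ : (Fin m → ℂ) → ℝ} (hψ : ContDiff ℝ ∞ ψ) (hψc : HasCompactSupport ψ)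
    {A : Set (Fin m → ℂ)} (hA : IsCompact A)
    (hAΩ : (fun p : (Fin m → ℂ) × (Fin m → ℂ) => p.1 + p.2) '' (tsupport ψ ×ˢ A) ⊆
      (openTube Ω : Set (Fin m → ℂ))) {w : ℕ → Fin m → ℂ} (hw : ∀ j, w j ∈ A)
    (b : ℕ →ᵇ ℝ) : 𝓓(openTube Ω, ℝ) where
  toFun z := ∑' j, ((1 / 2 : ℝ) ^ j * b j) * ψ (z - w j)
  contDiff' := contDiff_superposition hψ hψc w b
  hasCompactSupport' := HasCompactSupport.intro ((IsCompact.prod hψc hA).image continuous_add)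
    fun _ hz => superposition_eq_zero hw b hz
  tsupport_subset' := by
    refine (closure_minimal (fun z hz => ?_)
      ((IsCompact.prod hψc hA).image continuous_add).isClosed).trans hAΩ
    by_contra h
    exact hz (superposition_eq_zero hw b h)

/-- The Banach–Steinhaus theorem for an almost periodic regular distribution: its values on the
real translates of a compact family of translates of one test function are bounded. -/
theorem exists_abs_integral_le {u : (Fin m → ℂ) → ℝ}
    (hu : LocallyIntegrableOn u (openTube Ω : Set (Fin m → ℂ)))
    (hap : IsAPDistribution (regularDistribution (openTube Ω) u))
    {ψ : (Fin m → ℂ) → ℝ} (hψ : ContDiff ℝ ∞ ψ) (hψc : HasCompactSupport ψ)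
    {A : Set (Fin m → ℂ)} (hA : IsCompact A)
    (hAΩ : (fun p : (Fin m → ℂ) × (Fin m → ℂ) => p.1 + p.2) '' (tsupport ψ ×ˢ A) ⊆
      (openTube Ω : Set (Fin m → ℂ))) :
    ∃ M : ℝ, ∀ w ∈ A, ∀ t : Fin m → ℝ, |∫ z, ψ (z - w) * u (z + realVec t)| ≤ M := by
  by_contra! h
  -- The growth `2 ^ j * j` beats the weight `2⁻ʲ`: the `j`th unit sequence will produce a value
  -- larger than `j`.
  choose w hw t ht using fun j : ℕ => h (2 ^ j * j)
  obtain ⟨M₀, hM₀⟩ := hψ.continuous.bounded_above_of_compact_support hψc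
  set Φ : (ℕ →ᵇ ℝ) → 𝓓(openTube Ω, ℝ) := superposition hψ hψc hA hAΩ hw with hΦ
  have hΦa : ∀ b z, Φ b z = ∑' j, ((1 / 2 : ℝ) ^ j * b j) * ψ (z - w j) := fun _ _ => rfl
  have hint : ∀ s b, Integrable fun z => Φ b z * u (z + realVec s) := fun s b =>
    integrable_mul_comp_add_realVec hu s (Φ b)
  have hadd : ∀ b b' z, Φ (b + b') z = Φ b z + Φ b' z := by
    intro b b' z
    rw [hΦa, hΦa, hΦa, ← (summable_superposition hM₀ w b z).tsum_add
      (summable_superposition hM₀ w b' z)]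
    refine tsum_congr fun j => ?_
    rw [BoundedContinuousFunction.add_apply]
    ring
  have hsmul : ∀ (c : ℝ) b z, Φ (c • b) z = c * Φ b z := by
    intro c b z
    rw [hΦa, hΦa, ← tsum_mul_left]
    refine tsum_congr fun j => ?_
    rw [BoundedContinuousFunction.smul_apply, smul_eq_mul]
    ring
  set T := (fun p : (Fin m → ℂ) × (Fin m → ℂ) => p.1 + p.2) '' (tsupport ψ ×ˢ A) with hT
  have hTc : IsCompact T := (IsCompact.prod hψc hA).image continuous_add
  have huT : ∀ s : Fin m → ℝ, IntegrableOn (fun z => u (z + realVec s)) T := by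
    intro s
    have hTs : IsCompact ((fun z => z + realVec s) '' T) :=
      hTc.image (continuous_add_const _)
    have h1 : IntegrableOn u ((fun z => z + realVec s) '' T) := by
      refine hu.integrableOn_compact_subset ?_ hTs
      rintro _ ⟨z, hz, rfl⟩
      exact (add_realVec_mem_tube s).2 (hAΩ hz)
    exact ((measurePreserving_add_right volume (realVec s)).integrableOn_image
      (MeasurableEquiv.addRight (realVec s)).measurableEmbedding).1 h1
  have hlin : ∀ s : Fin m → ℝ, IsLinearMap ℝ fun b => ∫ z, Φ b z * u (z + realVec s) := by
    intro s
    refine ⟨fun b b' => ?_, fun c b => ?_⟩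
    · rw [← integral_add (hint s b) (hint s b')]
      refine integral_congr_ae (ae_of_all _ fun z => ?_)
      simp only [hadd]
      ring
    · rw [smul_eq_mul, ← integral_const_mul]
      refine integral_congr_ae (ae_of_all _ fun z => ?_)
      simp only [hsmul]
      ring
  set G : (Fin m → ℝ) → (ℕ →ᵇ ℝ) →L[ℝ] ℝ := fun s =>
    (IsLinearMap.mk' _ (hlin s)).mkContinuous (2 * M₀ * ∫ z in T, ‖u (z + realVec s)‖) (by
      intro b
      rw [IsLinearMap.mk'_apply]
      calc ‖∫ z, Φ b z * u (z + realVec s)‖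
          ≤ ∫ z, T.indicator (fun z => 2 * (‖b‖ * M₀) * ‖u (z + realVec s)‖) z := by
            refine norm_integral_le_of_norm_le
              ((integrable_indicator_iff hTc.measurableSet).2 ((huT s).norm.const_mul _))
              (ae_of_all _ fun z => ?_)
            by_cases hz : z ∈ T
            · rw [indicator_of_mem hz, norm_mul]
              gcongr
              exact norm_superposition_le hM₀ w b z
            · have : Φ b z = 0 := superposition_eq_zero hw b hz
              simp [this, hz]
        _ = 2 * M₀ * (∫ z in T, ‖u (z + realVec s)‖) * ‖b‖ := by
            rw [integral_indicator hTc.measurableSet, integral_const_mul]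
            ring) with hG
  have hGa : ∀ s b, G s b = ∫ z, Φ b z * u (z + realVec s) := fun _ _ => rfl
  -- The Banach space is that of bounded coefficient sequences. Pointwise boundedness over all
  -- shifts holds because each `Φ b` is itself a test function and almost periodic functions are
  -- bounded.
  obtain ⟨C, hC⟩ := banach_steinhaus (g := G) fun b => by
    obtain ⟨C, hC⟩ := (hap (Φ b)).exists_norm_le
    refine ⟨C, fun s => ?_⟩
    rw [hGa, ← regularDistribution_translate hu]
    exact hC s
  obtain ⟨n, hn⟩ := exists_nat_gt C
  set e : ℕ →ᵇ ℝ := BoundedContinuousFunction.ofNormedAddCommGroupDiscrete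
    (Pi.single n (1 : ℝ)) 1 (fun j => by
      by_cases hj : j = n
      · subst hj; simp
      · simp [hj]) with he
  have he1 : ‖e‖ ≤ 1 := BoundedContinuousFunction.norm_ofNormedAddCommGroup_le _ zero_le_one _
  have hΦe : ∀ z, Φ e z = (1 / 2 : ℝ) ^ n * ψ (z - w n) := by
    intro z
    rw [hΦa, tsum_eq_single n]
    · simp [he]
    · intro j hj
      simp [he, hj]
  have h1 : |G (t n) e| ≤ C := by
    have := (G (t n)).le_opNorm e
    rw [Real.norm_eq_abs] at this
    refine this.trans ((mul_le_mul (hC _) he1 (norm_nonneg _) ?_).trans (mul_one C).le)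
    exact (norm_nonneg _).trans (hC (t n))
  rw [hGa] at h1
  simp only [hΦe, mul_assoc] at h1
  rw [integral_const_mul, abs_mul, abs_of_nonneg (by positivity)] at h1
  have h2 := ht n
  have h3 : (1 / 2 : ℝ) ^ n * (2 ^ n * n) = n := by
    rw [← mul_assoc, ← mul_pow]
    norm_num
  have h4 : (0 : ℝ) < (1 / 2 : ℝ) ^ n := by positivity
  nlinarith [mul_lt_mul_of_pos_left h2 h4]

end Superposition

/-! ### A rotation invariant bump function -/

section Bump

variable {m : ℕ}

/-- A smooth bump function on `ℂᵐ`, invariant under rotations and supported in a ball. -/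
def radialBump (r : ℝ) (ζ : Fin m → ℂ) : ℝ :=
  Real.smoothTransition (1 - (∑ j, ‖ζ j‖ ^ 2) / r ^ 2)

theorem contDiff_radialBump (r : ℝ) : ContDiff ℝ ∞ (radialBump r : (Fin m → ℂ) → ℝ) := by
  refine Real.smoothTransition.contDiff.comp (contDiff_const.sub (ContDiff.div_const ?_ _))
  exact ContDiff.sum fun j _ => (contDiff_norm_sq ℝ).comp (contDiff_apply ℝ ℂ j)

theorem radialBump_nonneg (r : ℝ) (ζ : Fin m → ℂ) : 0 ≤ radialBump r ζ :=
  Real.smoothTransition.nonneg _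

theorem radialBump_zero (r : ℝ) : radialBump r (0 : Fin m → ℂ) = 1 := by
  simp [radialBump, Real.smoothTransition.one]

theorem radialBump_circle_smul (r θ : ℝ) (ζ : Fin m → ℂ) :
    radialBump r (circleMap 0 1 θ • ζ) = radialBump r ζ := by
  simp [radialBump]

theorem radialBump_eq_zero {r : ℝ} (hr : 0 < r) {ζ : Fin m → ℂ} (hζ : r < ‖ζ‖) :
    radialBump r ζ = 0 := by
  refine Real.smoothTransition.zero_of_nonpos ?_
  rw [sub_nonpos, one_le_div (by positivity)]
  by_contra! h
  refine absurd hζ (not_lt.2 ((pi_norm_le_iff_of_nonneg hr.le).2 fun j => ?_))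
  refine le_of_sq_le_sq ?_ hr.le
  exact (Finset.single_le_sum (f := fun j => ‖ζ j‖ ^ 2) (fun i _ => sq_nonneg _)
    (Finset.mem_univ j)).trans h.le

theorem tsupport_radialBump_subset {r : ℝ} (hr : 0 < r) :
    tsupport (radialBump r : (Fin m → ℂ) → ℝ) ⊆ closedBall 0 r := by
  refine closure_minimal (fun ζ hζ => ?_) isClosed_closedBall
  rw [mem_closedBall_zero_iff]
  by_contra! h
  exact hζ (radialBump_eq_zero hr h)

theorem hasCompactSupport_radialBump {r : ℝ} (hr : 0 < r) :
    HasCompactSupport (radialBump r : (Fin m → ℂ) → ℝ) :=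
  (isCompact_closedBall _ _).of_isClosed_subset (isClosed_tsupport _)
    (tsupport_radialBump_subset hr)

theorem integrable_radialBump {r : ℝ} (hr : 0 < r) :
    Integrable (radialBump r : (Fin m → ℂ) → ℝ) :=
  (contDiff_radialBump r).continuous.integrable_of_hasCompactSupport (hasCompactSupport_radialBump hr)

theorem integral_radialBump_pos {r : ℝ} (hr : 0 < r) :
    0 < ∫ ζ : Fin m → ℂ, radialBump r ζ :=
  (contDiff_radialBump r).continuous.integral_pos_of_hasCompactSupport_nonneg_nonzero
    (hasCompactSupport_radialBump hr) (radialBump_nonneg r) (x := 0)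
    (by rw [radialBump_zero]; exact one_ne_zero)

/-- The sub-mean value property of `log |f|` for a smooth rotation invariant weight. -/
theorem integral_radialBump_mul_log_le {U : Set (Fin m → ℂ)} {f : (Fin m → ℂ) → ℂ}
    (hU : IsOpen U) (hf : DifferentiableOn ℂ f U) (hfm : Measurable f)
    (hne : ∀ᵐ z, z ∈ U → f z ≠ 0) {z : Fin m → ℂ} {r : ℝ} (hr : 0 < r) (hzU : closedBall z r ⊆ U)
    (hz : f z ≠ 0) (hint : Integrable fun ζ => radialBump r ζ * Real.log ‖f (z + ζ)‖) :
    (∫ ζ : Fin m → ℂ, radialBump r ζ) * Real.log ‖f z‖ ≤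
      ∫ ζ, radialBump r ζ * Real.log ‖f (z + ζ)‖ := by
  obtain ⟨C, hC₀⟩ := (isCompact_closedBall z r).exists_bound_of_continuousOn
    (hf.continuousOn.mono hzU)
  have hC : ∀ w ∈ closedBall z r, ‖f w‖ ≤ Real.exp C := fun w hw =>
    (hC₀ w hw).trans (by linarith [Real.add_one_le_exp C])
  have hz' : ‖f z‖ ≠ 0 := by simpa using hz
  have hzC : 0 ≤ C - Real.log ‖f z‖ :=
    sub_nonneg.2 (log_le_of_norm_le (norm_nonneg _) hz' (hC z (mem_closedBall_self hr.le)))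
  have hb := integrable_radialBump (m := m) hr
  have h := lintegral_weight_negLog_le hU hf hfm hzU hz hC
    (ρ := fun ζ => ENNReal.ofReal (radialBump r ζ))
    (contDiff_radialBump r).continuous.measurable.ennreal_ofReal
    (fun θ ζ => by rw [radialBump_circle_smul])
    (fun ζ hζ => by rw [radialBump_eq_zero hr hζ, ENNReal.ofReal_zero])
  have hne' : ∀ᵐ ζ, z + ζ ∈ U → f (z + ζ) ≠ 0 :=
    (measurePreserving_add_left volume z).quasiMeasurePreserving.ae hne
  have hpt : ∀ᵐ ζ, ENNReal.ofReal (radialBump r ζ) * negLog C ‖f (z + ζ)‖ =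
      ENNReal.ofReal (radialBump r ζ * (C - Real.log ‖f (z + ζ)‖)) ∧
      0 ≤ radialBump r ζ * (C - Real.log ‖f (z + ζ)‖) := by
    filter_upwards [hne'] with ζ hζ
    by_cases hζr : r < ‖ζ‖
    · simp [radialBump_eq_zero hr hζr]
    have hmem : z + ζ ∈ closedBall z r := by simpa [dist_eq_norm] using hζr
    have hn : ‖f (z + ζ)‖ ≠ 0 := by simpa using hζ (hzU hmem)
    rw [negLog_of_ne hn, ENNReal.ofReal_mul (radialBump_nonneg r ζ)]
    exact ⟨rfl, mul_nonneg (radialBump_nonneg r ζ)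
      (sub_nonneg.2 (log_le_of_norm_le (norm_nonneg _) hn (hC _ hmem)))⟩
  have hint' : Integrable fun ζ => radialBump r ζ * (C - Real.log ‖f (z + ζ)‖) := by
    simp only [mul_sub]
    exact (hb.mul_const C).sub hint
  rw [lintegral_congr_ae (hpt.mono fun ζ h => h.1),
    ← ofReal_integral_eq_lintegral_ofReal hint' (hpt.mono fun ζ h => h.2),
    ← ofReal_integral_eq_lintegral_ofReal hb (ae_of_all _ (radialBump_nonneg r)),
    negLog_of_ne hz', ← ENNReal.ofReal_mul (integral_radialBump_pos hr).le,
    ENNReal.ofReal_le_ofReal_iff (mul_nonneg (integral_radialBump_pos hr).le hzC)] at h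
  simp only [mul_sub] at h
  rw [integral_sub (hb.mul_const C) hint, integral_mul_const] at h
  linarith

end Bump

/-! ### Boundedness and Lipschitz estimates from almost periodic `log |f|` -/

section Backward

variable {m : ℕ} {Ω : Opens (Fin m → ℝ)}

theorem dist_imVec_le (z w : Fin m → ℂ) : dist (imVec z) (imVec w) ≤ dist z w := by
  refine (dist_pi_le_iff dist_nonneg).2 fun j => ?_
  refine le_trans ?_ (dist_le_pi_dist z w j)
  rw [Real.dist_eq, Complex.dist_eq]
  simpa [imVec] using Complex.abs_im_le_norm (z j - w j)

theorem dist_imagVec_le (y y' : Fin m → ℝ) : dist (imagVec y) (imagVec y') ≤ dist y y' := by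
  refine (dist_pi_le_iff dist_nonneg).2 fun j => ?_
  refine le_trans (le_of_eq ?_) (dist_le_pi_dist y y' j)
  rw [Real.dist_eq, Complex.dist_eq, imagVec, imagVec, ← sub_mul, ← Complex.ofReal_sub, norm_mul,
    Complex.norm_I, mul_one, Complex.norm_real, Real.norm_eq_abs]

theorem closedBall_subset_tube_cthickening {K : Set (Fin m → ℝ)} {z : Fin m → ℂ} (hz : z ∈ tube K)
    (r : ℝ) : closedBall z r ⊆ tube (cthickening r K) := fun w hw =>
  mem_cthickening_of_dist_le _ _ r K hz ((dist_imVec_le w z).trans hw)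

/-- If `log |f|` is an almost periodic distribution, then `f` is bounded on tubes with compact
base. -/
theorem exists_norm_le_of_isAPDistribution (hΩ : IsPreconnected (Ω : Set (Fin m → ℝ)))
    {f : (Fin m → ℂ) → ℂ} (hf : DifferentiableOn ℂ f (tube (Ω : Set (Fin m → ℝ))))
    (hfm : Measurable f) (hf0 : ∃ z ∈ tube (Ω : Set (Fin m → ℝ)), f z ≠ 0)
    (hap : IsAPDistribution (regularDistribution (openTube Ω) fun z => Real.log ‖f z‖))
    {K : Set (Fin m → ℝ)} (hK : IsCompact K) (hKΩ : K ⊆ (Ω : Set (Fin m → ℝ))) :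
    ∃ C : ℝ, ∀ z ∈ tube K, ‖f z‖ ≤ Real.exp C := by
  have hu : LocallyIntegrableOn (fun z => Real.log ‖f z‖) (openTube Ω : Set (Fin m → ℂ)) :=
    locallyIntegrableOn_log_norm (isOpen_tube Ω.isOpen) (isPreconnected_tube hΩ) hf hfm hf0
  have hne := ae_ne_zero_of_differentiableOn (isOpen_tube Ω.isOpen) (isPreconnected_tube hΩ) hf
    hfm hf0
  obtain ⟨r, hr, hrΩ⟩ := hK.exists_cthickening_subset_open Ω.isOpen hKΩ
  have hballΩ : ∀ z ∈ tube K, closedBall z r ⊆ tube (Ω : Set (Fin m → ℝ)) := fun z hz =>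
    (closedBall_subset_tube_cthickening hz r).trans (tube_mono hrΩ)
  obtain ⟨M, hM⟩ := exists_abs_integral_le hu hap (contDiff_radialBump r)
    (hasCompactSupport_radialBump hr) (hK.image continuous_imagVec) (by
      rintro _ ⟨⟨ζ, w⟩, ⟨hζ, y, hy, rfl⟩, rfl⟩
      refine hballΩ (imagVec y) (by simpa [tube, imVec_imagVec] using hy) ?_
      simpa [dist_eq_norm] using tsupport_radialBump_subset hr hζ)
  set I := ∫ ζ : Fin m → ℂ, radialBump r ζ with hI
  have hI0 : 0 < I := integral_radialBump_pos hr
  refine ⟨M / I, fun z hz => ?_⟩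
  by_cases hfz : f z = 0
  · rw [hfz, norm_zero]
    exact (Real.exp_pos _).le
  have hfz' : 0 < ‖f z‖ := norm_pos_iff.2 hfz
  rw [← Real.log_le_iff_le_exp hfz', le_div_iff₀ hI0, mul_comm]
  have huball : IntegrableOn (fun w => Real.log ‖f w‖) (closedBall z r) :=
    hu.integrableOn_compact_subset (hballΩ z hz) (isCompact_closedBall z r)
  have hint : Integrable fun ζ => radialBump r ζ * Real.log ‖f (z + ζ)‖ := by
    have h1 : Integrable fun w => radialBump r (w - z) * Real.log ‖f w‖ := by
      rw [← integrableOn_iff_integrable_of_support_subset (s := closedBall z r)]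
      · refine huball.bdd_mul (c := 1) ?_ (ae_of_all _ fun w => ?_)
        · exact ((contDiff_radialBump r).continuous.comp
            (continuous_id.sub continuous_const)).aestronglyMeasurable
        · rw [Real.norm_of_nonneg (radialBump_nonneg _ _)]
          exact Real.smoothTransition.le_one _
      · intro w hw
        by_contra h
        refine hw ?_
        have : radialBump r (w - z) = 0 :=
          radialBump_eq_zero hr (by simpa [dist_eq_norm] using h)
        simp [this]
    simpa using h1.comp_add_left z
  refine (integral_radialBump_mul_log_le (isOpen_tube Ω.isOpen) hf hfm hne hr (hballΩ z hz) hfz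
    hint).trans ?_
  refine le_of_eq_of_le ?_ ((le_abs_self _).trans (hM _ ⟨imVec z, hz, rfl⟩ (reVec z)))
  -- Splitting `z` into `iy` and its real part turns the mean about `z` into a pairing with the bump
  -- at `iy`, shifted by `reVec z`; these are the pairings bounded by `M`.
  rw [← integral_add_left_eq_self (fun w => radialBump r (w - imagVec (imVec z)) *
    Real.log ‖f (w + realVec (reVec z))‖) (imagVec (imVec z))]
  refine integral_congr_ae (ae_of_all _ fun ζ => ?_)
  simp only [add_sub_cancel_left]
  rw [add_right_comm, imagVec_add_realVec]

/-- A holomorphic function bounded on tubes with compact base is uniformly Lipschitz there. -/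
theorem norm_sub_le_of_norm_le {U : Set (Fin m → ℂ)} {f : (Fin m → ℂ) → ℂ}
    (hf : DifferentiableOn ℂ f U) {z : Fin m → ℂ} {R B : ℝ} (hz : ball z R ⊆ U)
    (hB : ∀ w ∈ ball z R, ‖f w‖ ≤ B) {w : Fin m → ℂ} (hw : w ∈ ball z R) :
    ‖f w - f z‖ ≤ 2 * B / R * ‖w - z‖ := by
  have hR : 0 < R := pos_of_mem_ball hw
  have h := Complex.dist_le_div_mul_dist_of_mapsTo_ball (R₂ := 2 * B) (hf.mono hz) (fun x hx => by
    rw [mem_closedBall, dist_eq_norm]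
    linarith [norm_sub_le (f x) (f z), hB x hx, hB z (mem_ball_self hR)]) hw
  rwa [dist_eq_norm, dist_eq_norm] at h

end Backward

/-! ### Extraction of subsequences -/

section Subsequences

variable {X : Type*}

theorem exists_diagonal_subseq {R : ℕ → X → X → Prop}
    (hR : ∀ j, ∀ h : ℕ → X, ∃ k : ℕ → ℕ, StrictMono k ∧ ∀ n n', R j (h (k n)) (h (k n')))
    (h : ℕ → X) : ∃ k : ℕ → ℕ, StrictMono k ∧
      ∀ j, ∀ n ≥ j, ∀ n' ≥ j, R j (h (k n)) (h (k n')) := by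
  choose s hs hsR using hR
  -- `κ (j + 1)` refines `κ j`, so the diagonal lies in the range of `κ j` from index `j` on.
  let κ : ℕ → ℕ → ℕ := fun j => Nat.rec (s 0 h) (fun j κj => κj ∘ s (j + 1) (h ∘ κj)) j
  have hκs : ∀ j, κ (j + 1) = κ j ∘ s (j + 1) (h ∘ κ j) := fun j => rfl
  have hκm : ∀ j, StrictMono (κ j) := by
    intro j
    induction j with
    | zero => exact hs 0 h
    | succ j ih => rw [hκs]; exact ih.comp (hs _ _)
  have hκR : ∀ j n n', R j (h (κ j n)) (h (κ j n')) := by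
    intro j n n'
    cases j with
    | zero => exact hsR 0 h n n'
    | succ j => rw [hκs]; exact hsR (j + 1) (h ∘ κ j) n n'
  have hκrange : ∀ j n, j ≤ n → ∀ p, ∃ q, κ n p = κ j q := by
    intro j n hjn
    induction n, hjn using Nat.le_induction with
    | base => exact fun p => ⟨p, rfl⟩
    | succ n _ ih => exact fun p => ih (s (n + 1) (h ∘ κ n) p)
  refine ⟨fun n => κ n n, strictMono_nat_of_lt_succ fun n => ?_, fun j n hn n' hn' => ?_⟩
  · rw [hκs]
    exact (hκm n) ((Nat.lt_succ_self n).trans_le ((hs _ _).id_le _))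
  · obtain ⟨q, hq⟩ := hκrange j n hn n
    obtain ⟨q', hq'⟩ := hκrange j n' hn' n'
    change R j (h (κ n n)) (h (κ n' n'))
    rw [hq, hq']
    exact hκR j q q'

theorem exists_subseq_forall_finset {ι : Type*} {R : ι → X → X → Prop}
    (hR : ∀ i, ∀ h : ℕ → X, ∃ k : ℕ → ℕ, StrictMono k ∧ ∀ n n', R i (h (k n)) (h (k n')))
    (s : Finset ι) (h : ℕ → X) :
    ∃ k : ℕ → ℕ, StrictMono k ∧ ∀ i ∈ s, ∀ n n', R i (h (k n)) (h (k n')) := by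
  classical
  induction s using Finset.induction with
  | empty => exact ⟨id, strictMono_id, by simp⟩
  | insert a s _ ih =>
    obtain ⟨k, hk, hks⟩ := ih
    obtain ⟨k', hk', hk's⟩ := hR a (h ∘ k)
    refine ⟨k ∘ k', hk.comp hk', fun i hi n n' => ?_⟩
    rcases Finset.mem_insert.1 hi with rfl | hi
    · exact hk's n n'
    · exact hks i hi (k' n) (k' n')

theorem IsAPFunction.exists_subseq {m : ℕ} {E : Type*} [NormedAddCommGroup E]
    {u : (Fin m → ℝ) → E} (hu : IsAPFunction u) {κ : ℝ} (hκ : 0 < κ) (h : ℕ → Fin m → ℝ) :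
    ∃ k : ℕ → ℕ, StrictMono k ∧ ∀ n n', ∀ t, dist (u (t + h (k n))) (u (t + h (k n'))) < κ := by
  obtain ⟨k, hk, g, hg⟩ := hu.2 h
  rw [← tendstoUniformlyOn_univ] at hg
  obtain ⟨N, hN⟩ := Metric.uniformCauchySeqOn_iff.1 hg.uniformCauchySeqOn κ hκ
  exact ⟨fun n => k (n + N), fun a b hab => hk (by simpa using hab), fun n n' t =>
    hN _ (Nat.le_add_left _ _) _ (Nat.le_add_left _ _) t (mem_univ t)⟩

end Subsequences

/-! ### Almost periodic `log |f|` implies almost periodic modulus -/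

section Backward

variable {m : ℕ} {Ω : Opens (Fin m → ℝ)}

/-- The radial bump function of radius `r` centred at `w`, as a test function. -/
def bumpAt {r : ℝ} (hr : 0 < r) {w : Fin m → ℂ}
    (hw : closedBall w r ⊆ tube (Ω : Set (Fin m → ℝ))) : 𝓓(openTube Ω, ℝ) where
  toFun z := radialBump r (z - w)
  contDiff' := (contDiff_radialBump r).comp (contDiff_id.sub contDiff_const)
  hasCompactSupport' := (hasCompactSupport_radialBump hr).comp_homeomorph (Homeomorph.subRight w)
  tsupport_subset' := by
    refine (closure_minimal (fun z hz => ?_) isClosed_closedBall).trans hw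
    by_contra h
    exact hz (radialBump_eq_zero hr (by simpa [dist_eq_norm] using h))

theorem bumpAt_apply {r : ℝ} (hr : 0 < r) {w : Fin m → ℂ}
    (hw : closedBall w r ⊆ tube (Ω : Set (Fin m → ℝ))) (z : Fin m → ℂ) :
    bumpAt hr hw z = radialBump r (z - w) := rfl

theorem mul_exp_neg_le_log_sub_log {C p q ε : ℝ} (hε : 0 < ε) (hq : 0 < q) (hqp : q + ε ≤ p)
    (hp : p ≤ Real.exp C) : ε * Real.exp (-C) ≤ Real.log p - Real.log q := by
  have hp0 : 0 < p := by linarith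
  have h1 : Real.log q - Real.log p ≤ q / p - 1 := by
    rw [← Real.log_div hq.ne' hp0.ne']
    exact Real.log_le_sub_one_of_pos (div_pos hq hp0)
  have h2 : ε / p ≤ 1 - q / p := by
    rw [le_sub_iff_add_le, ← add_div, div_le_one hp0]
    linarith
  have h3 : ε * Real.exp (-C) ≤ ε / p := by
    rw [Real.exp_neg, div_eq_mul_inv]
    gcongr
  linarith

/-- Closeness of the translates of `log |f|` on finitely many test functions forces uniform
closeness of the translates of `|f|` on a tube with compact base. -/
theorem exists_finset_bumpAt (hΩ : IsPreconnected (Ω : Set (Fin m → ℝ)))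
    {f : (Fin m → ℂ) → ℂ} (hf : DifferentiableOn ℂ f (tube (Ω : Set (Fin m → ℝ))))
    (hfm : Measurable f) (hf0 : ∃ z ∈ tube (Ω : Set (Fin m → ℝ)), f z ≠ 0)
    (hap : IsAPDistribution (regularDistribution (openTube Ω) fun z => Real.log ‖f z‖))
    {K : Set (Fin m → ℝ)} (hK : IsCompact K) (hKΩ : K ⊆ (Ω : Set (Fin m → ℝ)))
    {ε : ℝ} (hε : 0 < ε) :
    ∃ s : Set 𝓓(openTube Ω, ℝ), s.Finite ∧ ∃ κ > 0, ∀ a b : Fin m → ℝ,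
      (∀ φ ∈ s, ∀ t : Fin m → ℝ,
        dist (regularDistribution (openTube Ω) (fun z => Real.log ‖f z‖) (translate (t + a) φ))
          (regularDistribution (openTube Ω) (fun z => Real.log ‖f z‖) (translate (t + b) φ)) < κ) →
      ∀ z ∈ tube K, |‖f (z + realVec a)‖ - ‖f (z + realVec b)‖| ≤ ε := by
  have hu : LocallyIntegrableOn (fun z => Real.log ‖f z‖) (openTube Ω : Set (Fin m → ℂ)) :=
    locallyIntegrableOn_log_norm (isOpen_tube Ω.isOpen) (isPreconnected_tube hΩ) hf hfm hf0
  have hne := ae_ne_zero_of_differentiableOn (isOpen_tube Ω.isOpen) (isPreconnected_tube hΩ) hf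
    hfm hf0
  obtain ⟨R, hR, hRΩ⟩ := hK.exists_cthickening_subset_open Ω.isOpen hKΩ
  obtain ⟨C, hC⟩ := exists_norm_le_of_isAPDistribution hΩ hf hfm hf0 hap
    (hK.cthickening (r := R)) hRΩ
  have hballR : ∀ z ∈ tube K, closedBall z R ⊆ tube (cthickening R K) := fun z hz =>
    closedBall_subset_tube_cthickening hz R
  set L := 2 * Real.exp C / R with hL
  have hL0 : 0 < L := by positivity
  have hLip : ∀ z ∈ tube K, ∀ w ∈ ball z R, ‖f w - f z‖ ≤ L * ‖w - z‖ := fun z hz w hw =>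
    norm_sub_le_of_norm_le hf
      (ball_subset_closedBall.trans ((hballR z hz).trans (tube_mono hRΩ)))
      (fun x hx => hC x (hballR z hz (ball_subset_closedBall hx))) hw
  -- The points compared below are at distance at most `2 * r`: this stays inside the Lipschitz ball
  -- of radius `R`, and each modulus moves by at most `ε / 4`.
  set r := min (R / 4) (ε / (8 * L)) with hr
  have hr0 : 0 < r := lt_min (by positivity) (by positivity)
  have hrR : r ≤ R / 4 := min_le_left _ _
  have hrL : L * (2 * r) ≤ ε / 4 := by
    have : r ≤ ε / (8 * L) := min_le_right _ _
    rw [le_div_iff₀ (by positivity)] at this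
    linarith
  have hballΩ : ∀ y : K, closedBall (imagVec (y : Fin m → ℝ)) r ⊆ tube (Ω : Set (Fin m → ℝ)) :=
    fun y => (closedBall_subset_closedBall (by linarith)).trans
      ((hballR _ (by simp [tube, imVec_imagVec])).trans (tube_mono hRΩ))
  obtain ⟨N, hNK, hNf, hN⟩ := finite_cover_balls_of_compact hK hr0
  have hNf' : Finite N := hNf
  set I := ∫ ζ : Fin m → ℂ, radialBump r ζ with hI
  have hI0 : 0 < I := integral_radialBump_pos hr0
  -- One bump at `iy` for each point of a finite `r`-net of `K`. The threshold is the mass `I` times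
  -- the least gap of the logarithms when the moduli differ by `ε / 2` below `e^C`.
  refine ⟨range fun y : N => bumpAt hr0 (hballΩ ⟨y, hNK y.2⟩), finite_range _,
    I * (ε / 2 * Real.exp (-C)), by positivity, fun a b hab z hz => ?_⟩
  by_contra! hcon
  wlog hle : ‖f (z + realVec b)‖ ≤ ‖f (z + realVec a)‖ generalizing a b
  · refine this b a (fun φ hφ t => ?_) ?_ (le_of_not_ge hle)
    · rw [dist_comm]
      exact hab φ hφ t
    · rwa [abs_sub_comm]
  rw [abs_of_nonneg (sub_nonneg.2 hle)] at hcon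
  obtain ⟨y, hyN, hy⟩ := mem_iUnion₂.1 (hN hz)
  have hyK : y ∈ K := hNK hyN
  set φ : 𝓓(openTube Ω, ℝ) := bumpAt hr0 (hballΩ ⟨y, hyK⟩) with hφ
  set t := reVec z with ht
  have hφI : ∫ w, φ w = I := by
    simp only [hφ, bumpAt_apply]
    exact integral_sub_right_eq_self _ _
  have key : I * (ε / 2 * Real.exp (-C)) ≤ (∫ w, φ w * Real.log ‖f (w + realVec (t + a))‖) -
      ∫ w, φ w * Real.log ‖f (w + realVec (t + b))‖ := by
    have hia := integrable_mul_comp_add_realVec hu (t + a) φ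
    have hib := integrable_mul_comp_add_realVec hu (t + b) φ
    rw [← integral_sub hia hib, ← hφI, ← integral_mul_const]
    have hφi : Integrable fun w => φ w :=
      φ.continuous.integrable_of_hasCompactSupport φ.hasCompactSupport
    have hneb : ∀ᵐ w, w + realVec (t + b) ∈ tube (Ω : Set (Fin m → ℝ)) →
        f (w + realVec (t + b)) ≠ 0 :=
      (measurePreserving_add_right volume (realVec (t + b))).quasiMeasurePreserving.ae hne
    refine integral_mono_ae (hφi.mul_const _) (hia.sub hib) ?_
    filter_upwards [hneb] with w hwb
    simp only [← mul_sub]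
    by_cases hw : r < ‖w - imagVec y‖
    · have : φ w = 0 := radialBump_eq_zero hr0 hw
      simp [this]
    refine mul_le_mul_of_nonneg_left ?_ (radialBump_nonneg _ _)
    have hwr : dist w (imagVec y) ≤ r := by rw [dist_eq_norm]; exact not_lt.1 hw
    have hwb' : f (w + realVec (t + b)) ≠ 0 :=
      hwb ((add_realVec_mem_tube _).2 (hballΩ ⟨y, hyK⟩ hwr))
    have hdist : ∀ c : Fin m → ℝ, ‖w + realVec (t + c) - (z + realVec c)‖ ≤ 2 * r := by
      intro c
      have h1 : w + realVec (t + c) - (z + realVec c) = w - imagVec (imVec z) := by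
        rw [realVec_add]
        nth_rewrite 1 [← imagVec_add_realVec z]
        abel
      rw [h1, ← dist_eq_norm]
      have h2 := dist_triangle w (imagVec y) (imagVec (imVec z))
      have h3 := dist_imagVec_le y (imVec z)
      have h4 : dist (imVec z) y < r := hy
      rw [dist_comm] at h4
      linarith
    have hest : ∀ c : Fin m → ℝ, |‖f (w + realVec (t + c))‖ - ‖f (z + realVec c)‖| ≤ ε / 4 := by
      intro c
      refine (abs_norm_sub_norm_le _ _).trans ((hLip (z + realVec c)
        ((add_realVec_mem_tube c).2 hz) _ ?_).trans ?_)
      · rw [mem_ball, dist_eq_norm]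
        linarith [hdist c]
      · exact (mul_le_mul_of_nonneg_left (hdist c) hL0.le).trans hrL
    have ha := abs_le.1 (hest a)
    have hb := abs_le.1 (hest b)
    refine mul_exp_neg_le_log_sub_log (by positivity) (norm_pos_iff.2 hwb') (by linarith) ?_
    refine hC _ ((add_realVec_mem_tube _).2 ?_)
    exact hballR (imagVec y) (by simpa [tube, imVec_imagVec] using hyK)
      (mem_closedBall.2 (hwr.trans (by linarith)))
  have := hab φ ⟨⟨y, hyN⟩, rfl⟩ t
  rw [regularDistribution_translate hu, regularDistribution_translate hu, Real.dist_eq] at this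
  exact absurd (key.trans (le_abs_self _)) (not_le.2 this)

theorem isAPOnTubeDomain_of_isAPDistribution (hΩ : IsPreconnected (Ω : Set (Fin m → ℝ)))
    {f : (Fin m → ℂ) → ℂ} (hf : DifferentiableOn ℂ f (tube (Ω : Set (Fin m → ℝ))))
    (hfm : Measurable f) (hf0 : ∃ z ∈ tube (Ω : Set (Fin m → ℝ)), f z ≠ 0)
    (hap : IsAPDistribution (regularDistribution (openTube Ω) fun z => Real.log ‖f z‖)) :
    IsAPOnTubeDomain Ω fun z => ‖f z‖ := by
  refine ⟨hf.continuousOn.norm, fun K hK hKΩ =>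
    ⟨hf.continuousOn.norm.mono (tube_mono hKΩ), fun h => ?_⟩⟩
  obtain ⟨k, hk, hkR⟩ := exists_diagonal_subseq
    (R := fun j (a b : Fin m → ℝ) => ∀ z ∈ tube K,
      |‖f (z + realVec a)‖ - ‖f (z + realVec b)‖| ≤ 1 / ((j : ℝ) + 1)) (fun j h => by
      obtain ⟨s, hs, κ, hκ, hsκ⟩ := exists_finset_bumpAt hΩ hf hfm hf0 hap hK hKΩ
        (ε := 1 / ((j : ℝ) + 1)) (by positivity)
      obtain ⟨k, hk, hkR⟩ := exists_subseq_forall_finset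
        (R := fun (φ : 𝓓(openTube Ω, ℝ)) (a b : Fin m → ℝ) => ∀ t : Fin m → ℝ,
          dist (regularDistribution (openTube Ω) (fun z => Real.log ‖f z‖) (translate (t + a) φ))
            (regularDistribution (openTube Ω) (fun z => Real.log ‖f z‖) (translate (t + b) φ)) < κ)
        (fun (φ : 𝓓(openTube Ω, ℝ)) h => (hap φ).exists_subseq hκ h) hs.toFinset h
      exact ⟨k, hk, fun n n' => hsκ _ _ fun φ hφ =>
        hkR φ (hs.mem_toFinset.2 hφ) n n'⟩) h
  refine ⟨k, hk, exists_tendstoUniformlyOn_of_dist_lt fun ε hε => ?_⟩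
  obtain ⟨j, hj⟩ := exists_nat_one_div_lt hε
  exact ⟨j, fun n hn n' hn' z hz => (hkR j n hn n' hn' z hz).trans_lt hj⟩

end Backward

/-! ### Independence of the values outside the tube -/

section Congruence

variable {m : ℕ} {Ω : Opens (Fin m → ℝ)}

theorem IsAPOnTubeDomain.congr {E : Type*} [NormedAddCommGroup E] {u v : (Fin m → ℂ) → E}
    (hu : IsAPOnTubeDomain Ω u) (huv : EqOn u v (tube (Ω : Set (Fin m → ℝ)))) :
    IsAPOnTubeDomain Ω v := by
  refine ⟨hu.1.congr huv.symm, fun K hK hKΩ => ?_⟩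
  have huvK : EqOn u v (tube K) := huv.mono (tube_mono hKΩ)
  refine ⟨(hu.2 K hK hKΩ).1.congr huvK.symm, fun h => ?_⟩
  obtain ⟨k, hk, g, hg⟩ := (hu.2 K hK hKΩ).2 h
  exact ⟨k, hk, g, hg.congr (Eventually.of_forall fun n z hz =>
    huvK ((add_realVec_mem_tube _).2 hz))⟩

theorem locallyIntegrableOn_congr {U : Set (Fin m → ℂ)} (hU : IsOpen U) {u v : (Fin m → ℂ) → ℝ}
    (hu : LocallyIntegrableOn u U) (huv : EqOn u v U) : LocallyIntegrableOn v U := by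
  rw [locallyIntegrableOn_iff hU.isLocallyClosed] at hu ⊢
  exact fun k hkU hk => (hu k hkU hk).congr_fun (huv.mono hkU) hk.measurableSet

theorem regularDistribution_congr {U : Opens (Fin m → ℂ)} {u v : (Fin m → ℂ) → ℝ}
    (hu : LocallyIntegrableOn u (U : Set (Fin m → ℂ))) (huv : EqOn u v U) :
    regularDistribution U u = regularDistribution U v := by
  have hv := locallyIntegrableOn_congr U.isOpen hu huv
  ext φ
  rw [regularDistribution_apply hu, regularDistribution_apply hv]
  refine integral_congr_ae (ae_of_all _ fun z => ?_)
  by_cases hz : z ∈ (U : Set (Fin m → ℂ))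
  · simp only [huv hz]
  · have : φ z = 0 := image_eq_zero_of_notMem_tsupport fun h => hz (φ.tsupport_subset h)
    simp [this]

end Congruence

end AlmostPeriodic

end

theorem mainTheorem2 {m : ℕ} (Ω : TopologicalSpace.Opens (Fin m → ℝ))
    (hΩ : IsConnected (Ω : Set (Fin m → ℝ)))
    (f : (Fin m → ℂ) → ℂ)
    (hf : DifferentiableOn ℂ f (AlmostPeriodic.tube (Ω : Set (Fin m → ℝ))))
    (hf0 : ∃ z ∈ AlmostPeriodic.tube (Ω : Set (Fin m → ℝ)), f z ≠ 0) :
    MeasureTheory.LocallyIntegrableOn (fun z => Real.log ‖f z‖)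
        (AlmostPeriodic.tube (Ω : Set (Fin m → ℝ))) ∧
      (AlmostPeriodic.IsAPOnTubeDomain Ω (fun z => ‖f z‖) ↔
        AlmostPeriodic.IsAPDistribution
          (AlmostPeriodic.regularDistribution (AlmostPeriodic.openTube Ω)
            (fun z => Real.log ‖f z‖))) := by
  have hU : IsOpen (AlmostPeriodic.tube (Ω : Set (Fin m → ℝ))) :=
    AlmostPeriodic.isOpen_tube Ω.isOpen
  -- Outside the tube `f` is arbitrary, possibly not measurable; extending by zero gives a globally
  -- measurable function without affecting any of the assertions.
  set F := (AlmostPeriodic.tube (Ω : Set (Fin m → ℝ))).indicator f with hF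
  have hFf : Set.EqOn F f (AlmostPeriodic.tube (Ω : Set (Fin m → ℝ))) := fun z hz =>
    Set.indicator_of_mem hz f
  have hFm : Measurable F := by
    classical
    rw [hF, ← Set.piecewise_eq_indicator]
    exact hf.continuousOn.measurable_piecewise continuousOn_const hU.measurableSet
  have hFd : DifferentiableOn ℂ F (AlmostPeriodic.tube (Ω : Set (Fin m → ℝ))) := hf.congr hFf
  have hF0 : ∃ z ∈ AlmostPeriodic.tube (Ω : Set (Fin m → ℝ)), F z ≠ 0 := by
    obtain ⟨z, hz, hfz⟩ := hf0
    exact ⟨z, hz, by rwa [hFf hz]⟩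
  have hnorm : Set.EqOn (fun z => ‖F z‖) (fun z => ‖f z‖)
      (AlmostPeriodic.tube (Ω : Set (Fin m → ℝ))) := fun z hz => by simp only [hFf hz]
  have hlog : Set.EqOn (fun z => Real.log ‖F z‖) (fun z => Real.log ‖f z‖)
      (AlmostPeriodic.tube (Ω : Set (Fin m → ℝ))) := fun z hz => by simp only [hFf hz]
  have hFi := AlmostPeriodic.locallyIntegrableOn_log_norm hU
    (AlmostPeriodic.isPreconnected_tube hΩ.isPreconnected) hFd hFm hF0
  refine ⟨AlmostPeriodic.locallyIntegrableOn_congr hU hFi hlog, ?_⟩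
  rw [← AlmostPeriodic.regularDistribution_congr (U := AlmostPeriodic.openTube Ω) hFi hlog]
  exact ⟨fun h => AlmostPeriodic.isAPDistribution_of_isAPOnTubeDomain hΩ.isPreconnected hFd hFm
      hF0 (h.congr hnorm.symm),
    fun h => (AlmostPeriodic.isAPOnTubeDomain_of_isAPDistribution hΩ.isPreconnected hFd hFm
      hF0 h).congr hnorm⟩
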